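/- **Setting.** Split the coordinates of $\mathbb R^d$ as $z=(z_\sigma,z_{\bar\sigma})$ with $\sigma\neq\emptyset$, and let $p$ be a probability density on $\mathbb R^d$. For every $z_{\bar\sigma}$ whose marginal density satisfies $0<p(z_{\bar\sigma})<\infty$, let $p(z_\sigma\mid z_{\bar\sigma})=p(z_\sigma,z_{\bar\sigma})/p(z_{\bar\sigma})$ and let $\mu_{\sigma|\bar\sigma}(z_{\bar\sigma})$ and $\Sigma_{\sigma|\bar\sigma}(z_{\bar\sigma})$ be the mean and the covariance matrix of this conditional density. Let $\mathcal Q$ be the family of all nondegenerate Gaussians $q=\mathcal N(\nu,S)$ on $\mathbb R^d$ ($S$ positive definite), with conditional location and scale $$\nu_{\sigma|\bar\sigma}(z_{\bar\sigma})=\nu_\sigma+S_{\sigma\bar\sigma}S_{\bar\sigma\bar\sigma}^{-1}(z_{\bar\sigma}-\nu_{\bar\sigma}),\qquad S_{\sigma|\bar\sigma}=S_{\sigma\sigma}-S_{\sigma\bar\sigma}S_{\bar\sigma\bar\sigma}^{-1}S_{\bar\sigma\sigma}.$$ **Theorem.** Suppose there are a positive definite matrix $M$ with $\operatorname{trace}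 M=|\sigma|$, a vector $\alpha$ and a matrix $A$ such that, for every $z_{\bar\sigma}$ as above and with $m(z_{\bar\sigma})=\alpha+Az_{\bar\sigma}$: 1. $p(\cdot\mid z_{\bar\sigma})$ is elliptically symmetric about $m(z_{\bar\sigma})$ with normalized covariance matrix $M$, i.e. its value at $z_\sigma$ depends only on $\|z_\sigma-m(z_{\bar\sigma})\|_{M^{-1}}=\sqrt{(z_\sigma-m(z_{\bar\sigma}))^TM^{-1}(z_\sigma-m(z_{\bar\sigma}))}$; 2. $p(z_\sigma\mid z_{\bar\sigma})=|M|^{-1/2}\exp\big(f_{z_{\bar\sigma}}(\|z_\sigma-m(z_{\bar\sigma})\|_{M^{-1}})\big)$ for a continuously differentiable function $f_{z_{\bar\sigma}}:[0,\infty)\to\mathbb R$ (with finite one-sided derivative at $0$); 3. $p(\cdot\mid z_{\bar\sigma})$ is log concave on $\mathbb R^{|\sigma|}$ and strictly log concave on some nonempty open set. Suppose also that $\mathrm{KL}(q\|p)<\infty$ for at least one $q\in\mathcal Q$. Then every minimizer $q=\mathcal N(\nu,S)$ of $\mathrm{KL}(q\|p)$ over $\mathcal Q$ satisfies, for every $z_{\bar\sigma}$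 as above, $$\nu_{\sigma|\bar\sigma}(z_{\bar\sigma})=\mu_{\sigma|\bar\sigma}(z_{\bar\sigma})\qquad\text{and}\qquad S_{\sigma|\bar\sigma}=\gamma^2\,\Sigma_{\sigma|\bar\sigma}(z_{\bar\sigma})\ \text{ for a unique }\gamma=\gamma(z_{\bar\sigma})>0,$$ and $S_{\sigma|\bar\sigma}=\gamma_0^2M$ for a unique $\gamma_0>0$ (not depending on $z_{\bar\sigma}$). Moreover, two minimizers have the same $S_{\sigma|\bar\sigma}$ (hence the same factors) if they have the same marginal $\mathcal N(\nu_{\bar\sigma},S_{\bar\sigma\bar\sigma})$; and if $f_{z_{\bar\sigma}}$ does not depend on $z_{\bar\sigma}$, then all minimizers have the same $S_{\sigma|\bar\sigma}$ (hence the same factors). -/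

import Mathlib

open MeasureTheory Matrix InformationTheory

namespace EllipticalVI

noncomputable section

/-- The Mahalanobis distance `√((x - c)ᵀ M⁻¹ (x - c))`. -/
def mahalanobis {ι : Type*} [Fintype ι] [DecidableEq ι]
    (M : Matrix ι ι ℝ) (c x : ι → ℝ) : ℝ :=
  √((x - c) ⬝ᵥ M⁻¹ *ᵥ (x - c))

/-- `f` is elliptically symmetric about `c` with normalized covariance matrix `M`. -/
structure IsEllipticallySymmetric {ι : Type*} [Fintype ι] [DecidableEq ι]
    (f : (ι → ℝ) → ℝ) (c : ι → ℝ) (M : Matrix ι ι ℝ) : Prop where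
  posDef : M.PosDef
  trace_eq : M.trace = Fintype.card ι
  eq_of_mahalanobis_eq : ∀ z z' : ι → ℝ, mahalanobis M c z = mahalanobis M c z' → f z = f z'

/-- A nonnegative function `f` that is log concave on the whole space and strictly log concave on
some nonempty open set. The open set may be taken convex, by passing to a ball inside it. Log
concavity is written multiplicatively, so that zeros of `f` are treated correctly. -/
structure SomewhereStrictlyLogConcave {ι : Type*} (f : (ι → ℝ) → ℝ) : Prop where
  nonneg : ∀ x, 0 ≤ f x
  logConcave : ∀ x y : ι → ℝ, ∀ a b : ℝ, 0 ≤ a → 0 ≤ b → a + b = 1 →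
    f x ^ a * f y ^ b ≤ f (a • x + b • y)
  strict : ∃ U : Set (ι → ℝ), IsOpen U ∧ U.Nonempty ∧ Convex ℝ U ∧
    ∀ x ∈ U, ∀ y ∈ U, x ≠ y → ∀ a b : ℝ, 0 < a → 0 < b → a + b = 1 →
      f x ^ a * f y ^ b < f (a • x + b • y)

section Conditional

variable {s t : Type*} [Fintype s]

/-- The marginal density in the last block of coordinates. -/
def marginal (p : (s ⊕ t → ℝ) → ℝ) (y : t → ℝ) : ℝ :=
  ∫ x : s → ℝ, p (Sum.elim x y)

/-- The conditional density of the first block of coordinates given that the last one is `y`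
(meaningful when `0 < marginal p y`). -/
def condDensity (p : (s ⊕ t → ℝ) → ℝ) (y : t → ℝ) (x : s → ℝ) : ℝ :=
  p (Sum.elim x y) / marginal p y

/-- The conditional mean of the first block given the last one. -/
def condMean (p : (s ⊕ t → ℝ) → ℝ) (y : t → ℝ) : s → ℝ :=
  fun i => ∫ x : s → ℝ, x i * condDensity p y x

/-- The conditional covariance matrix of the first block given the last one. -/
def condCov (p : (s ⊕ t → ℝ) → ℝ) (y : t → ℝ) : Matrix s s ℝ :=
  Matrix.of fun i j =>
    ∫ x : s → ℝ, (x i - condMean p y i) * (x j - condMean p y j) * condDensity p y x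

end Conditional

/-- The density of the (nondegenerate) Gaussian with location `ν` and scale (covariance) `S`. -/
def gaussianDensity {ι : Type*} [Fintype ι] [DecidableEq ι]
    (ν : ι → ℝ) (S : Matrix ι ι ℝ) (z : ι → ℝ) : ℝ :=
  (√((2 * Real.pi) ^ Fintype.card ι * S.det))⁻¹ * Real.exp (-((z - ν) ⬝ᵥ S⁻¹ *ᵥ (z - ν)) / 2)

section Blocks

variable {s t : Type*} [Fintype t] [DecidableEq t]

/-- The conditional location `ν_σ + S_{σσ̄} S_{σ̄σ̄}⁻¹ (y - ν_σ̄)` of a Gaussian. -/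
def condLoc (ν : s ⊕ t → ℝ) (S : Matrix (s ⊕ t) (s ⊕ t) ℝ) (y : t → ℝ) : s → ℝ :=
  ν ∘ Sum.inl + (S.toBlocks₁₂ * S.toBlocks₂₂⁻¹) *ᵥ (y - ν ∘ Sum.inr)

/-- The conditional scale matrix `S_{σσ} - S_{σσ̄} S_{σ̄σ̄}⁻¹ S_{σ̄σ}` of a Gaussian. -/
def condScale (S : Matrix (s ⊕ t) (s ⊕ t) ℝ) : Matrix s s ℝ :=
  S.toBlocks₁₁ - S.toBlocks₁₂ * S.toBlocks₂₂⁻¹ * S.toBlocks₂₁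

end Blocks

section GaussianFacts

open scoped MatrixOrder in
theorem integral_gaussianDensity {ι : Type*} [Fintype ι] [DecidableEq ι]
    (ν : ι → ℝ) {S : Matrix ι ι ℝ} (hS : S.PosDef) : ∫ z, gaussianDensity ν S z = 1 := by
  obtain ⟨C, hC⟩ := (CStarAlgebra.nonneg_iff_eq_star_mul_self.mp hS.inv.posSemidef.nonneg)
  have hC' : S⁻¹ = Cᵀ * C := by rw [hC]; simp [star_eq_conjTranspose]
  have hdS := hS.det_pos
  have hdet : S.det⁻¹ = C.det ^ 2 := by
    have := congrArg det hC'
    rw [det_nonsing_inv, det_mul, det_transpose] at this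
    simpa [sq] using this
  have hC0 : C.det ≠ 0 := by
    intro h; rw [h] at hdet; simp at hdet; exact hdS.ne' hdet
  have hq : ∀ z, z ⬝ᵥ S⁻¹ *ᵥ z = ∑ i, (C *ᵥ z) i ^ 2 := by
    intro z
    rw [hC', ← mulVec_mulVec, dotProduct_mulVec, vecMul_transpose]
    simp [dotProduct, sq]
  have h1 : ∫ z, gaussianDensity ν S z = ∫ z, gaussianDensity 0 S z := by
    rw [← integral_sub_right_eq_self (fun z => gaussianDensity 0 S z) ν]
    simp [gaussianDensity]
  have hg : ∫ w : ι → ℝ, ∏ i, Real.exp (-(1/2) * w i ^ 2) =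
      √(2 * Real.pi) ^ Fintype.card ι := by
    rw [integral_fintype_prod_volume_eq_pow (fun x : ℝ => Real.exp (-(1/2) * x ^ 2)),
      integral_gaussian]
    congr 2; ring
  have hmap := Real.map_matrix_volume_pi_eq_smul_volume_pi hC0
  have h2 : ∫ z : ι → ℝ, ∏ i, Real.exp (-(1/2) * (C *ᵥ z) i ^ 2) =
      |C.det|⁻¹ * √(2 * Real.pi) ^ Fintype.card ι := by
    have := integral_map (μ := (volume : Measure (ι → ℝ))) (φ := toLin' C)
      (f := fun w : ι → ℝ => ∏ i, Real.exp (-(1/2) * w i ^ 2))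
      (by exact (LinearMap.continuous_of_finiteDimensional _).aemeasurable)
      (Continuous.aestronglyMeasurable (by fun_prop))
    rw [hmap, integral_smul_measure, hg] at this
    simp only [toLin'_apply] at this
    rw [← this, ENNReal.toReal_ofReal (abs_nonneg _), abs_inv, smul_eq_mul]
  have h3 : ∀ z, gaussianDensity 0 S z = (√((2 * Real.pi) ^ Fintype.card ι * S.det))⁻¹ *
      ∏ i, Real.exp (-(1/2) * (C *ᵥ z) i ^ 2) := by
    intro z
    rw [gaussianDensity, sub_zero, hq, ← Real.exp_sum, ← Finset.mul_sum]
    congr 2; ring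
  rw [h1]
  simp_rw [h3]
  rw [integral_const_mul, h2]
  have hdS' : S.det = (|C.det|⁻¹) ^ 2 := by
    rw [inv_pow, sq_abs, ← hdet, inv_inv]
  have hp : (2 * Real.pi) ^ Fintype.card ι = (√(2 * Real.pi) ^ Fintype.card ι) ^ 2 := by
    rw [← pow_mul, mul_comm _ 2, pow_mul, Real.sq_sqrt (by positivity)]
  rw [hp, hdS', ← mul_pow, Real.sqrt_sq (by positivity)]
  have : 0 < |C.det| := abs_pos.mpr hC0
  field_simp

variable {s t : Type*} [Fintype s] [DecidableEq s] [Fintype t] [DecidableEq t]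

theorem gaussianDensity_sumElim (ν : s ⊕ t → ℝ) {S : Matrix (s ⊕ t) (s ⊕ t) ℝ} (hS : S.PosDef)
    (x : s → ℝ) (y : t → ℝ) :
    (condScale S).PosDef ∧
    gaussianDensity ν S (Sum.elim x y) = gaussianDensity (condLoc ν S y) (condScale S) x *
      gaussianDensity (ν ∘ Sum.inr) S.toBlocks₂₂ y := by
  obtain ⟨A, B, C, D, rfl⟩ : ∃ A B C D, S = fromBlocks A B C D :=
    ⟨_, _, _, _, (fromBlocks_toBlocks S).symm⟩
  have hCB : C = Bᵀ := by
    have := hS.isHermitian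
    rw [isHermitian_fromBlocks_iff] at this
    simpa using this.2.1.symm
  subst hCB
  have hD : D.PosDef := by
    have := hS.submatrix (e := (Sum.inr : t → s ⊕ t)) Sum.inr_injective
    exact this
  have hDt : D.IsSymm := by simpa [IsHermitian, IsSymm] using hD.isHermitian
  have hDu : IsUnit D.det := hD.det_pos.ne'.isUnit
  let : Invertible D := D.invertibleOfIsUnitDet hDu
  have hdet : (fromBlocks A B Bᵀ D).det = D.det * (A - B * D⁻¹ * Bᵀ).det := by
    rw [det_fromBlocks₂₂, invOf_eq_nonsing_inv]
  have hSc : (A - B * D⁻¹ * Bᵀ).PosDef := by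
    have h1 : (A - B * D⁻¹ * Bᵀ).PosSemidef := by
      have := (hD.fromBlocks₂₂ A B).mp (by simpa using hS.posSemidef)
      simpa using this
    refine h1.posDef_iff_isUnit.mpr ?_
    rw [isUnit_iff_isUnit_det]
    refine Ne.isUnit fun h => ?_
    have := hS.det_pos
    rw [hdet, h] at this
    simp at this
  have hScu : IsUnit (A - B * D⁻¹ * Bᵀ).det := hSc.det_pos.ne'.isUnit
  refine ⟨by simpa [condScale] using hSc, ?_⟩
  set v : s ⊕ t → ℝ := Sum.elim x y - ν with hv
  set w := (fromBlocks A B Bᵀ D)⁻¹ *ᵥ v with hw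
  have hvw : v = fromBlocks A B Bᵀ D *ᵥ w := by
    rw [hw, mulVec_mulVec, mul_nonsing_inv _ hS.det_pos.ne'.isUnit, one_mulVec]
  set a := w ∘ Sum.inl with ha
  set b := w ∘ Sum.inr with hb
  have hwab : w = Sum.elim a b := by ext (i|i) <;> rfl
  have hy : y - ν ∘ Sum.inr = Bᵀ *ᵥ a + D *ᵥ b := by
    have := congrArg (· ∘ Sum.inr) hvw
    rw [hwab, fromBlocks_mulVec] at this
    rw [Sum.elim_comp_inr] at this
    exact this
  have hx : x - ν ∘ Sum.inl = A *ᵥ a + B *ᵥ b := by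
    have := congrArg (· ∘ Sum.inl) hvw
    rw [hwab, fromBlocks_mulVec] at this
    rw [Sum.elim_comp_inl] at this
    exact this
  have hDi : ∀ u, D⁻¹ *ᵥ (D *ᵥ u) = u := fun u => by
    rw [mulVec_mulVec, nonsing_inv_mul _ hDu, one_mulVec]
  have hSi : ∀ u, (A - B * D⁻¹ * Bᵀ)⁻¹ *ᵥ ((A - B * D⁻¹ * Bᵀ) *ᵥ u) = u := fun u => by
    rw [mulVec_mulVec, nonsing_inv_mul _ hScu, one_mulVec]
  have hxl : x - condLoc ν (fromBlocks A B Bᵀ D) y = (A - B * D⁻¹ * Bᵀ) *ᵥ a := by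
    simp only [condLoc, toBlocks_fromBlocks₁₂, toBlocks_fromBlocks₂₂]
    rw [← sub_sub, hx, hy, mulVec_add, ← mulVec_mulVec, ← mulVec_mulVec, hDi, sub_mulVec]
    simp only [mulVec_mulVec, Matrix.mul_assoc]
    abel
  have hquad : v ⬝ᵥ w = ((A - B * D⁻¹ * Bᵀ) *ᵥ a) ⬝ᵥ a +
      (Bᵀ *ᵥ a + D *ᵥ b) ⬝ᵥ (D⁻¹ *ᵥ (Bᵀ *ᵥ a) + b) := by
    have hv' : v = Sum.elim (A *ᵥ a + B *ᵥ b) (Bᵀ *ᵥ a + D *ᵥ b) := by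
      rw [← hx, ← hy]; ext (i|i) <;> rfl
    rw [hv', hwab, sumElim_dotProduct_sumElim]
    have e1 : (D *ᵥ b) ⬝ᵥ (D⁻¹ *ᵥ (Bᵀ *ᵥ a)) = (B *ᵥ b) ⬝ᵥ a := by
      rw [dotProduct_mulVec, ← mulVec_transpose, transpose_nonsing_inv, hDt.eq, hDi,
        dotProduct_mulVec, vecMul_transpose]
    have e2 : ((B * D⁻¹ * Bᵀ) *ᵥ a) ⬝ᵥ a = (Bᵀ *ᵥ a) ⬝ᵥ (D⁻¹ *ᵥ (Bᵀ *ᵥ a)) := by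
      rw [← mulVec_mulVec, ← mulVec_mulVec, dotProduct_comm _ a, dotProduct_mulVec,
        ← mulVec_transpose]
    rw [sub_mulVec, sub_dotProduct, e2]
    simp only [add_dotProduct, dotProduct_add, e1]
    ring
  have hsc : condScale (fromBlocks A B Bᵀ D) = A - B * D⁻¹ * Bᵀ := by simp [condScale]
  simp only [gaussianDensity]
  rw [← hv, ← hw, hquad, hsc, hxl, hy, hdet, toBlocks_fromBlocks₂₂, hSi, mulVec_add, hDi, Fintype.card_sum]
  rw [mul_mul_mul_comm, ← mul_inv, ← Real.exp_add, ← Real.sqrt_mul (mul_nonneg (by positivity) hSc.det_pos.le)]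
  congr 3
  · ring_nf
  · ring

/-- The conditional law of a Gaussian is the Gaussian with location `condLoc` and scale
`condScale`. -/
theorem condDensity_gaussianDensity (ν : s ⊕ t → ℝ) {S : Matrix (s ⊕ t) (s ⊕ t) ℝ}
    (hS : S.PosDef) (y : t → ℝ) :
    condDensity (gaussianDensity ν S) y = gaussianDensity (condLoc ν S y) (condScale S) := by
  have hD : S.toBlocks₂₂.PosDef :=
    hS.submatrix (e := (Sum.inr : t → s ⊕ t)) Sum.inr_injective
  have hpos : 0 < gaussianDensity (ν ∘ Sum.inr) S.toBlocks₂₂ y := by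
    have := hD.det_pos
    unfold gaussianDensity; positivity
  have hm : marginal (gaussianDensity ν S) y = gaussianDensity (ν ∘ Sum.inr) S.toBlocks₂₂ y := by
    unfold marginal
    simp_rw [fun x => (gaussianDensity_sumElim ν hS x y).2]
    rw [integral_mul_const, integral_gaussianDensity _ (gaussianDensity_sumElim ν hS 0 y).1,
      one_mul]
  funext x
  rw [condDensity, hm, (gaussianDensity_sumElim ν hS x y).2, mul_div_cancel_right₀ _ hpos.ne']

end GaussianFacts

/-- The probability measure with density `p` with respect to Lebesgue measure. -/
def densityMeasure {ι : Type*} [Fintype ι] (p : (ι → ℝ) → ℝ) : Measure (ι → ℝ) :=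
  volume.withDensity fun z => ENNReal.ofReal (p z)

/-- The reverse divergence `KL(q ‖ p)` of the Gaussian `q` with parameters `ν`, `S`
from the density `p`. -/
def gaussianKL {ι : Type*} [Fintype ι] [DecidableEq ι]
    (p : (ι → ℝ) → ℝ) (ν : ι → ℝ) (S : Matrix ι ι ℝ) : ENNReal :=
  klDiv (densityMeasure (gaussianDensity ν S)) (densityMeasure p)

/-- The Gaussian with parameters `ν`, `S` minimizes `KL(q ‖ p)` among all Gaussians. -/
def IsGaussianKLMinimizer {ι : Type*} [Fintype ι] [DecidableEq ι]
    (p : (ι → ℝ) → ℝ) (ν : ι → ℝ) (S : Matrix ι ι ℝ) : Prop :=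
  S.PosDef ∧ ∀ (ν' : ι → ℝ) (S' : Matrix ι ι ℝ), S'.PosDef →
    gaussianKL p ν S ≤ gaussianKL p ν' S'

end

end EllipticalVI

open EllipticalVI

/-! Every Gaussian with last-block marginal `N(ν, D)` is the law of `(b + B y + C w, y)`, where `w`
is standard and independent of `y ~ N(ν, D)`. Here `b + B y` is the conditional location and `C *
Cᵀ` the conditional scale. In these parameters the divergence from `p` is a constant depending on
`(ν, D)`, minus `log |det C|`, minus the expectation of `log p` at the sheared point
(`toReal_gaussianKL_shear`). A minimizer therefore maximizes `log |det C| + E log p` over all `(b,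
B, C)` with the marginal held fixed (`IsGaussianKLMinimizer.shear_le`).

The shear is affine in `(b, B, C)`, so log concavity of the conditionals makes `E log p` concave
(`shear_midpoint`). Symmetry of `p` combined with rotation invariance of `w` gives other parameters
with the same value (`shear_orthogonal`), and averaging with them cannot decrease `E log p`.

Location: reflection about `α + A y` maps `(b, B, C)` to `(2α - b, 2A - B, C)`, with midpoint `(α,
A, C)`. Optimality forces equality in the concavity inequality almost everywhere, and strict log
concavity on an open set then forces `b + B y = α + A y`.

Shape: with `M = P * Pᵀ` and `C = P * diagonal d`, exchanging two entries of `d` preserves `E log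
p`. Averaging the two diagonals strictly increases the determinant unless these entries agree, so
`C` is a multiple of `P` and the scale a multiple of `M`. The conditional covariance is a multiple
of `M` by the same symmetry (`moments`).

Factor: `log γ` is strictly concave, so for a fixed marginal the optimal `γ` is unique
(`shear_lt_of_ne`). With a common radial profile the change of `E log p` between two scales does not
depend on the marginal, so minimizers with different marginals can be compared too. -/

namespace EllipticalVI

set_option linter.unusedSectionVars false

/-! ### Measures given by Lebesgue densities -/

section DensityMeasure

variable {ι : Type*} [Fintype ι]

theorem isProbabilityMeasure_densityMeasure {p : (ι → ℝ) → ℝ} (hp : ∀ z, 0 ≤ p z)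
    (hint : ∫ z, p z = 1) : IsProbabilityMeasure (densityMeasure p) := by
  have hi : Integrable p := integrable_of_integral_eq_one hint
  refine ⟨?_⟩
  rw [densityMeasure, withDensity_apply _ MeasurableSet.univ, Measure.restrict_univ,
    ← ofReal_integral_eq_lintegral_ofReal hi (Filter.Eventually.of_forall hp), hint,
    ENNReal.ofReal_one]

theorem integrable_densityMeasure_iff {p : (ι → ℝ) → ℝ} (hm : Measurable p) (hp : ∀ z, 0 ≤ p z)
    {F : (ι → ℝ) → ℝ} :
    Integrable F (densityMeasure p) ↔ Integrable (fun z => p z * F z) := by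
  rw [densityMeasure, integrable_withDensity_iff_integrable_smul' hm.ennreal_ofReal (by simp)]
  simp [ENNReal.toReal_ofReal, hp]

end DensityMeasure

/-! ### Gaussian measures: log density and affine images -/

section GaussianMeasure

variable {ι : Type*} [Fintype ι] [DecidableEq ι]

theorem gaussianDensity_pos (ν : ι → ℝ) {S : Matrix ι ι ℝ} (hS : S.PosDef) (z : ι → ℝ) :
    0 < gaussianDensity ν S z := by
  have := hS.det_pos
  unfold gaussianDensity
  positivity

theorem continuous_gaussianDensity (ν : ι → ℝ) (S : Matrix ι ι ℝ) :
    Continuous (gaussianDensity ν S) := by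
  unfold gaussianDensity
  fun_prop

theorem integrable_gaussianDensity (ν : ι → ℝ) {S : Matrix ι ι ℝ} (hS : S.PosDef) :
    Integrable (gaussianDensity ν S) :=
  integrable_of_integral_eq_one (integral_gaussianDensity ν hS)

theorem quadForm_inv_nonneg {S : Matrix ι ι ℝ} (hS : S.PosDef) (z : ι → ℝ) :
    0 ≤ z ⬝ᵥ S⁻¹ *ᵥ z := by
  simpa using hS.inv.posSemidef.dotProduct_mulVec_nonneg z

theorem isProbabilityMeasure_gaussian (ν : ι → ℝ) {S : Matrix ι ι ℝ} (hS : S.PosDef) :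
    IsProbabilityMeasure (densityMeasure (gaussianDensity ν S)) :=
  isProbabilityMeasure_densityMeasure (fun z => (gaussianDensity_pos ν hS z).le)
    (integral_gaussianDensity ν hS)

theorem ae_gaussian_iff (ν : ι → ℝ) {S : Matrix ι ι ℝ} (hS : S.PosDef) {P : (ι → ℝ) → Prop} :
    (∀ᵐ z ∂densityMeasure (gaussianDensity ν S), P z) ↔ ∀ᵐ z, P z := by
  rw [densityMeasure, ae_withDensity_iff (continuous_gaussianDensity ν S).measurable.ennreal_ofReal]
  simp [gaussianDensity_pos ν hS]

theorem log_gaussianDensity (ν : ι → ℝ) {S : Matrix ι ι ℝ} (hS : S.PosDef) (z : ι → ℝ) :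
    Real.log (gaussianDensity ν S z) =
      -Real.log (√((2 * Real.pi) ^ Fintype.card ι * S.det)) +
        -((z - ν) ⬝ᵥ S⁻¹ *ᵥ (z - ν)) / 2 := by
  have := hS.det_pos
  rw [gaussianDensity, Real.log_mul (by positivity) (by positivity), Real.log_inv, Real.log_exp]

/-- With `Q` the quadratic form of `S⁻¹`, `(Q / 2) exp (-Q / 2) ≤ 2 exp (-Q / 4)`, and the right
side is a multiple of the density with scale `2 S`. -/
theorem integrable_log_gaussianDensity (ν : ι → ℝ) {S : Matrix ι ι ℝ} (hS : S.PosDef) :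
    Integrable (fun z => Real.log (gaussianDensity ν S z))
      (densityMeasure (gaussianDensity ν S)) := by
  have := isProbabilityMeasure_gaussian ν hS
  simp_rw [log_gaussianDensity ν hS]
  refine (integrable_const _).add ?_
  rw [integrable_densityMeasure_iff (continuous_gaussianDensity ν S).measurable
    fun z => (gaussianDensity_pos ν hS z).le]
  have h2 : ((2 : ℝ) • S).PosDef := hS.smul two_pos
  have hdet := hS.det_pos
  have hi := (integrable_gaussianDensity ν h2).const_mul
    (2 * (√((2 * Real.pi) ^ Fintype.card ι * S.det))⁻¹ *
      √((2 * Real.pi) ^ Fintype.card ι * ((2 : ℝ) • S).det))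
  refine hi.mono' ?_ (Filter.Eventually.of_forall fun z => ?_)
  · have := continuous_gaussianDensity ν S
    exact Continuous.aestronglyMeasurable (by fun_prop)
  have hdet2 := h2.det_pos
  have hinv : ((2 : ℝ) • S)⁻¹ = (1 / 2 : ℝ) • S⁻¹ := by
    refine inv_eq_right_inv ?_
    rw [smul_mul_smul_comm, mul_nonsing_inv _ hdet.ne'.isUnit]
    norm_num
  have hq := quadForm_inv_nonneg hS (z - ν)
  simp only [gaussianDensity]
  rw [hinv, smul_mulVec, dotProduct_smul, smul_eq_mul]
  set Q := (z - ν) ⬝ᵥ S⁻¹ *ᵥ (z - ν)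
  rw [Real.norm_eq_abs, abs_mul, abs_of_nonneg (by positivity), neg_div, abs_neg,
    abs_of_nonneg (by positivity)]
  have key : Real.exp (-(Q / 2)) * (Q / 2) ≤ 2 * Real.exp (-(1 / 2 * Q) / 2) := by
    have h4 : Real.exp (-(Q / 2)) = Real.exp (-(1 / 2 * Q) / 2) * Real.exp (-(Q / 4)) := by
      rw [← Real.exp_add]; ring_nf
    have h5 : Real.exp (-(Q / 4)) * (Q / 4) ≤ 1 := by
      rw [Real.exp_neg, inv_mul_le_iff₀ (Real.exp_pos _), mul_one]
      linarith [Real.add_one_le_exp (Q / 4)]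
    rw [h4]
    nlinarith [Real.exp_pos (-(1 / 2 * Q) / 2)]
  have hs : 0 < √((2 * Real.pi) ^ Fintype.card ι * ((2 : ℝ) • S).det) := by positivity
  calc _ = (√((2 * Real.pi) ^ Fintype.card ι * S.det))⁻¹ * (Real.exp (-(Q / 2)) * (Q / 2)) := by
        ring
    _ ≤ (√((2 * Real.pi) ^ Fintype.card ι * S.det))⁻¹ * (2 * Real.exp (-(1 / 2 * Q) / 2)) := by
        gcongr
    _ = _ := by field_simp

theorem gaussianDensity_affine (ν b : ι → ℝ) {S K : Matrix ι ι ℝ} (hK : K.det ≠ 0) (z : ι → ℝ) :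
    |K.det| * gaussianDensity (b + K *ᵥ ν) (K * S * Kᵀ) (b + K *ᵥ z) = gaussianDensity ν S z := by
  have hKu : IsUnit K.det := hK.isUnit
  have hq : (b + K *ᵥ z - (b + K *ᵥ ν)) ⬝ᵥ (K * S * Kᵀ)⁻¹ *ᵥ (b + K *ᵥ z - (b + K *ᵥ ν)) =
      (z - ν) ⬝ᵥ S⁻¹ *ᵥ (z - ν) := by
    rw [add_sub_add_left_eq_sub, ← mulVec_sub, Matrix.mul_inv_rev, Matrix.mul_inv_rev,
      ← mulVec_mulVec, ← mulVec_mulVec, mulVec_mulVec _ K⁻¹, nonsing_inv_mul _ hKu, one_mulVec,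
      ← transpose_nonsing_inv, dotProduct_mulVec, vecMul_transpose, mulVec_mulVec,
      nonsing_inv_mul _ hKu, one_mulVec]
  have hd : (K * S * Kᵀ).det = K.det ^ 2 * S.det := by
    rw [det_mul, det_mul, det_transpose]; ring
  have h0 : 0 < |K.det| := abs_pos.mpr hK
  rw [gaussianDensity, gaussianDensity, hq, hd,
    show (2 * Real.pi) ^ Fintype.card ι * (K.det ^ 2 * S.det) =
      K.det ^ 2 * ((2 * Real.pi) ^ Fintype.card ι * S.det) by ring,
    Real.sqrt_mul (sq_nonneg _), Real.sqrt_sq_eq_abs, mul_inv, ← mul_assoc, ← mul_assoc,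
    mul_inv_cancel₀ h0.ne', one_mul]

theorem map_volume_affine (b : ι → ℝ) {K : Matrix ι ι ℝ} (hK : K.det ≠ 0) :
    Measure.map (fun z => b + K *ᵥ z) volume =
      ENNReal.ofReal |K.det|⁻¹ • (volume : Measure (ι → ℝ)) := by
  have h1 := Real.map_matrix_volume_pi_eq_smul_volume_pi hK
  have hm : Measurable (toLin' K) := (LinearMap.continuous_of_finiteDimensional _).measurable
  have : (fun z => b + K *ᵥ z) = (fun z => b + z) ∘ toLin' K := by ext; simp
  rw [this, ← Measure.map_map (measurable_const_add b) hm, h1, Measure.map_smul,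
    map_add_left_eq_self, abs_inv]

theorem map_gaussian_affine (ν b : ι → ℝ) {S K : Matrix ι ι ℝ} (hK : K.det ≠ 0) :
    Measure.map (fun z => b + K *ᵥ z) (densityMeasure (gaussianDensity ν S)) =
      densityMeasure (gaussianDensity (b + K *ᵥ ν) (K * S * Kᵀ)) := by
  have hT : Measurable (fun z : ι → ℝ => b + K *ᵥ z) :=
    Continuous.measurable (by fun_prop)
  have hK0 : 0 < |K.det| := abs_pos.mpr hK
  ext E hE
  rw [Measure.map_apply hT hE, densityMeasure, densityMeasure, withDensity_apply _ (hT hE),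
    withDensity_apply _ hE]
  have hg : Measurable fun z => ENNReal.ofReal (gaussianDensity (b + K *ᵥ ν) (K * S * Kᵀ) z) :=
    (continuous_gaussianDensity _ _).measurable.ennreal_ofReal
  have h1 : ∀ z, ENNReal.ofReal (gaussianDensity ν S z) = ENNReal.ofReal |K.det| *
      ENNReal.ofReal (gaussianDensity (b + K *ᵥ ν) (K * S * Kᵀ) (b + K *ᵥ z)) := fun z => by
    rw [← ENNReal.ofReal_mul hK0.le, gaussianDensity_affine ν b hK]
  simp_rw [h1]
  have h2 : Measurable fun z => ENNReal.ofReal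
      (gaussianDensity (b + K *ᵥ ν) (K * S * Kᵀ) (b + K *ᵥ z)) := hg.comp hT
  rw [lintegral_const_mul _ h2, ← setLIntegral_map hE hg hT, map_volume_affine b hK,
    Measure.restrict_smul, lintegral_smul_measure, smul_eq_mul, ← mul_assoc,
    ← ENNReal.ofReal_mul hK0.le, mul_inv_cancel₀ hK0.ne', ENNReal.ofReal_one, one_mul]

end GaussianMeasure

/-! ### The divergence as a difference of expected log densities -/

section Divergence

variable {ι : Type*} [Fintype ι] [DecidableEq ι]

/-- A Gaussian has the same null sets as Lebesgue measure. This is how finite divergence yields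
positivity of `p` almost everywhere. -/
theorem gaussian_ac_iff {p : (ι → ℝ) → ℝ} (hm : Measurable p)
    (ν : ι → ℝ) {S : Matrix ι ι ℝ} (hS : S.PosDef) :
    densityMeasure (gaussianDensity ν S) ≪ densityMeasure p ↔ ∀ᵐ z, 0 < p z := by
  constructor
  · intro h
    rw [← ae_gaussian_iff ν hS]
    refine h.ae_le ?_
    change ∀ᵐ z ∂densityMeasure p, 0 < p z
    rw [densityMeasure, ae_withDensity_iff hm.ennreal_ofReal]
    exact Filter.Eventually.of_forall fun z hz => by simpa using hz
  · intro h
    refine (withDensity_absolutelyContinuous _ _).trans ?_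
    refine withDensity_absolutelyContinuous' hm.ennreal_ofReal.aemeasurable ?_
    filter_upwards [h] with z hz
    simpa using hz

theorem llr_gaussian_ae_eq {p : (ι → ℝ) → ℝ} (hm : Measurable p)
    (hpos : ∀ᵐ z, 0 < p z) (ν : ι → ℝ) {S : Matrix ι ι ℝ} (hS : S.PosDef) :
    llr (densityMeasure (gaussianDensity ν S)) (densityMeasure p)
      =ᵐ[densityMeasure (gaussianDensity ν S)]
        fun z => Real.log (gaussianDensity ν S z) - Real.log (p z) := by
  have := isProbabilityMeasure_gaussian ν hS
  have h1 : (densityMeasure (gaussianDensity ν S)).rnDeriv (densityMeasure p) =ᵐ[volume]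
      fun z => (ENNReal.ofReal (p z))⁻¹ *
        (densityMeasure (gaussianDensity ν S)).rnDeriv volume z := by
    refine Measure.rnDeriv_withDensity_right _ _ hm.ennreal_ofReal.aemeasurable ?_ ?_
    · filter_upwards [hpos] with z hz
      simpa using hz
    · exact Filter.Eventually.of_forall fun z => by simp
  have h2 : (densityMeasure (gaussianDensity ν S)).rnDeriv volume =ᵐ[volume]
      fun z => ENNReal.ofReal (gaussianDensity ν S z) :=
    Measure.rnDeriv_withDensity _ (continuous_gaussianDensity ν S).measurable.ennreal_ofReal
  refine (withDensity_absolutelyContinuous _ _).ae_le ?_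
  filter_upwards [h1, h2, hpos] with z h1 h2 hz
  have hg := gaussianDensity_pos ν hS z
  rw [llr, h1, h2, ENNReal.toReal_mul, ENNReal.toReal_inv, ENNReal.toReal_ofReal hz.le,
    ENNReal.toReal_ofReal hg.le, Real.log_mul (by positivity) hg.ne', Real.log_inv]
  ring

theorem gaussianKL_ne_top_iff {p : (ι → ℝ) → ℝ} (hm : Measurable p)
    (ν : ι → ℝ) {S : Matrix ι ι ℝ} (hS : S.PosDef) :
    gaussianKL p ν S ≠ ⊤ ↔ (∀ᵐ z, 0 < p z) ∧
      Integrable (fun z => Real.log (p z)) (densityMeasure (gaussianDensity ν S)) := by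
  rw [gaussianKL, klDiv_ne_top_iff, gaussian_ac_iff hm ν hS]
  refine and_congr_right fun hpos => ?_
  rw [integrable_congr (llr_gaussian_ae_eq hm hpos ν hS)]
  have hl := integrable_log_gaussianDensity ν hS
  constructor
  · intro h
    refine (hl.sub h).congr (Filter.Eventually.of_forall fun z => ?_)
    simp
  · intro h
    exact hl.sub h

theorem toReal_gaussianKL {p : (ι → ℝ) → ℝ} (hm : Measurable p) (hp : ∀ z, 0 ≤ p z)
    (hint : ∫ z, p z = 1) (ν : ι → ℝ) {S : Matrix ι ι ℝ} (hS : S.PosDef)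
    (h : gaussianKL p ν S ≠ ⊤) :
    (gaussianKL p ν S).toReal =
      ∫ z, Real.log (gaussianDensity ν S z) ∂densityMeasure (gaussianDensity ν S) -
        ∫ z, Real.log (p z) ∂densityMeasure (gaussianDensity ν S) := by
  have := isProbabilityMeasure_gaussian ν hS
  have := isProbabilityMeasure_densityMeasure hp hint
  obtain ⟨hpos, hi⟩ := (gaussianKL_ne_top_iff hm ν hS).mp h
  rw [gaussianKL, toReal_klDiv_of_measure_eq ((gaussian_ac_iff hm ν hS).mpr hpos) (by simp),
    integral_congr_ae (llr_gaussian_ae_eq hm hpos ν hS),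
    integral_sub (integrable_log_gaussianDensity ν hS) hi]

/-- Only a lower bound has to be supplied: with `g` the Gaussian density, `log (p / g) ≤ p / g - 1`,
and `p / g` is integrable against `g` because `p` is integrable. -/
theorem integrable_log_of_le {p : (ι → ℝ) → ℝ} (hm : Measurable p)
    (hint : ∫ z, p z = 1) (hpos : ∀ᵐ z, 0 < p z) (ν : ι → ℝ) {S : Matrix ι ι ℝ} (hS : S.PosDef)
    {G : (ι → ℝ) → ℝ} (hG : Integrable G (densityMeasure (gaussianDensity ν S)))
    (hle : ∀ᵐ z, G z ≤ Real.log (p z)) :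
    Integrable (fun z => Real.log (p z)) (densityMeasure (gaussianDensity ν S)) := by
  have hpi : Integrable p := integrable_of_integral_eq_one hint
  have hl := integrable_log_gaussianDensity ν hS
  have hr : Integrable (fun z => p z / gaussianDensity ν S z)
      (densityMeasure (gaussianDensity ν S)) := by
    rw [integrable_densityMeasure_iff (continuous_gaussianDensity ν S).measurable
      fun z => (gaussianDensity_pos ν hS z).le]
    refine hpi.congr (Filter.Eventually.of_forall fun z => ?_)
    have := (gaussianDensity_pos ν hS z).ne'
    field_simp
  refine integrable_of_le_of_le (g₁ := G) (g₂ := fun z => p z / gaussianDensity ν S z +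
    Real.log (gaussianDensity ν S z)) hm.log.aestronglyMeasurable ?_ ?_ hG (hr.add hl)
  · exact (ae_gaussian_iff ν hS).mpr hle
  · refine (ae_gaussian_iff ν hS).mpr ?_
    filter_upwards [hpos] with z hz
    have hg := gaussianDensity_pos ν hS z
    have := Real.log_le_sub_one_of_pos (div_pos hz hg)
    rw [Real.log_div hz.ne' hg.ne'] at this
    linarith

end Divergence

/-! ### Gaussians with a given marginal as shears of a base Gaussian -/

section Shear

variable {s t : Type*} [Fintype s] [DecidableEq s] [Fintype t] [DecidableEq t]

/-- The map `(w, y) ↦ (b + B y + C w, y)`. -/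
def shear (b : s → ℝ) (B : Matrix s t ℝ) (C : Matrix s s ℝ) (z : s ⊕ t → ℝ) : s ⊕ t → ℝ :=
  Sum.elim (b + B *ᵥ (z ∘ Sum.inr) + C *ᵥ (z ∘ Sum.inl)) (z ∘ Sum.inr)

/-- The Gaussian measure whose first block is standard and independent of the second one. -/
noncomputable def baseGaussian (s : Type*) [Fintype s] [DecidableEq s] (ν : t → ℝ)
    (D : Matrix t t ℝ) : Measure (s ⊕ t → ℝ) :=
  densityMeasure (gaussianDensity (Sum.elim 0 ν) (fromBlocks 1 0 0 D))

theorem shear_eq_affine (b : s → ℝ) (B : Matrix s t ℝ) (C : Matrix s s ℝ) (z : s ⊕ t → ℝ) :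
    shear b B C z = Sum.elim b 0 + fromBlocks C B 0 1 *ᵥ z := by
  rw [fromBlocks_mulVec]
  ext (i | i) <;> simp [shear]
  ring

theorem det_shear (B : Matrix s t ℝ) (C : Matrix s s ℝ) :
    (fromBlocks C B 0 (1 : Matrix t t ℝ)).det = C.det := by
  rw [det_fromBlocks_zero₂₁, det_one, mul_one]

theorem continuous_shear (b : s → ℝ) (B : Matrix s t ℝ) (C : Matrix s s ℝ) :
    Continuous (shear b B C) := by
  simp_rw [funext (shear_eq_affine b B C)]
  fun_prop

theorem posDef_fromBlocks_one {D : Matrix t t ℝ} (hD : D.PosDef) :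
    (fromBlocks (1 : Matrix s s ℝ) 0 0 D).PosDef := by
  refine PosDef.of_dotProduct_mulVec_pos ?_ fun x hx => ?_
  · rw [isHermitian_fromBlocks_iff]
    exact ⟨isHermitian_one, by simp, by simp, hD.isHermitian⟩
  · obtain ⟨a, b, rfl⟩ : ∃ a b, x = Sum.elim a b :=
      ⟨x ∘ Sum.inl, x ∘ Sum.inr, by ext (i | i) <;> rfl⟩
    have ha : 0 ≤ a ⬝ᵥ a := by
      simpa using dotProduct_star_self_nonneg a
    have hb : 0 ≤ b ⬝ᵥ D *ᵥ b := by simpa using hD.posSemidef.dotProduct_mulVec_nonneg b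
    rw [star_trivial, fromBlocks_mulVec, sumElim_dotProduct_sumElim]
    simp only [Sum.elim_comp_inl, Sum.elim_comp_inr, one_mulVec, zero_mulVec, add_zero, zero_add]
    by_cases h : b = 0
    · have ha' : a ≠ 0 := by
        rintro rfl
        exact hx (by subst h; ext (i | i) <;> rfl)
      have : 0 < a ⬝ᵥ a := lt_of_le_of_ne ha fun h => ha' (dotProduct_self_eq_zero.mp h.symm)
      linarith
    · have : 0 < b ⬝ᵥ D *ᵥ b := by simpa using hD.dotProduct_mulVec_pos h
      linarith

theorem shear_cov (B : Matrix s t ℝ) (C : Matrix s s ℝ) (D : Matrix t t ℝ) :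
    fromBlocks C B 0 1 * fromBlocks 1 0 0 D * (fromBlocks C B 0 (1 : Matrix t t ℝ))ᵀ =
      fromBlocks (C * Cᵀ + B * D * Bᵀ) (B * D) (D * Bᵀ) D := by
  simp [fromBlocks_transpose, fromBlocks_multiply]

theorem posDef_shear_cov (B : Matrix s t ℝ) {C : Matrix s s ℝ} (hC : C.det ≠ 0)
    {D : Matrix t t ℝ} (hD : D.PosDef) :
    (fromBlocks (C * Cᵀ + B * D * Bᵀ) (B * D) (D * Bᵀ) D).PosDef := by
  rw [← shear_cov]
  refine (posDef_fromBlocks_one hD).mul_mul_conjTranspose_same ?_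
  rw [vecMul_injective_iff_isUnit, isUnit_iff_isUnit_det, det_shear]
  exact hC.isUnit

theorem map_shear_baseGaussian (b : s → ℝ) (B : Matrix s t ℝ) {C : Matrix s s ℝ}
    (hC : C.det ≠ 0) (ν : t → ℝ) (D : Matrix t t ℝ) :
    Measure.map (shear b B C) (baseGaussian s ν D) =
      densityMeasure (gaussianDensity (Sum.elim (b + B *ᵥ ν) ν)
        (fromBlocks (C * Cᵀ + B * D * Bᵀ) (B * D) (D * Bᵀ) D)) := by
  have h : (fromBlocks C B 0 (1 : Matrix t t ℝ)).det ≠ 0 := by rwa [det_shear]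
  rw [funext (shear_eq_affine b B C), baseGaussian, map_gaussian_affine _ _ h, shear_cov]
  congr 2
  rw [← shear_eq_affine]
  simp [shear]

/-- The affine function `condLoc ν S` determines `B`, by its increments from `0` to the basis
vectors. The blocks of `S` are then recovered from `B`, the last block and the Schur complement. -/
theorem shear_params {ν : s ⊕ t → ℝ} {S : Matrix (s ⊕ t) (s ⊕ t) ℝ} (hS : S.PosDef)
    {b : s → ℝ} {B : Matrix s t ℝ} {C : Matrix s s ℝ}
    (hb : ∀ y, b + B *ᵥ y = condLoc ν S y) (hC : C * Cᵀ = condScale S) :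
    Sum.elim (b + B *ᵥ (ν ∘ Sum.inr)) (ν ∘ Sum.inr) = ν ∧
      fromBlocks (C * Cᵀ + B * S.toBlocks₂₂ * Bᵀ) (B * S.toBlocks₂₂) (S.toBlocks₂₂ * Bᵀ)
        S.toBlocks₂₂ = S := by
  have hD : S.toBlocks₂₂.PosDef := hS.submatrix (e := (Sum.inr : t → s ⊕ t)) Sum.inr_injective
  have hDu : IsUnit S.toBlocks₂₂.det := hD.det_pos.ne'.isUnit
  have hDt : S.toBlocks₂₂ᵀ = S.toBlocks₂₂ := by simpa [IsHermitian] using hD.isHermitian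
  have hSt : S.toBlocks₁₂ᵀ = S.toBlocks₂₁ := by
    have h : Sᵀ = S := by simpa [IsHermitian] using hS.isHermitian
    conv_rhs => rw [← h]
    rfl
  have hB : B = S.toBlocks₁₂ * S.toBlocks₂₂⁻¹ := by
    refine ext_of_mulVec_single fun i => ?_
    have h1 := hb (Pi.single i 1)
    have h0 := hb 0
    simp only [condLoc, mulVec_sub, mulVec_zero] at h0 h1
    have := congrArg₂ (· - ·) h1 h0
    simpa using this
  constructor
  · rw [hb]
    ext (i | i) <;> simp [condLoc]
  · have h12 : B * S.toBlocks₂₂ = S.toBlocks₁₂ := by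
      rw [hB, Matrix.mul_assoc, nonsing_inv_mul _ hDu, Matrix.mul_one]
    have h21 : S.toBlocks₂₂ * Bᵀ = S.toBlocks₂₁ := by
      rw [← hSt, ← h12, transpose_mul, hDt]
    have h11 : C * Cᵀ + B * S.toBlocks₂₂ * Bᵀ = S.toBlocks₁₁ := by
      rw [hC, condScale, ← hB, Matrix.mul_assoc, h21, sub_add_cancel]
    rw [h11, h12, h21, fromBlocks_toBlocks]

theorem integrable_comp_shear_iff {b : s → ℝ} {B : Matrix s t ℝ} {C : Matrix s s ℝ}
    (hC : C.det ≠ 0) {ν : t → ℝ} {D : Matrix t t ℝ} {F : (s ⊕ t → ℝ) → ℝ} (hF : Measurable F) :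
    Integrable (fun z => F (shear b B C z)) (baseGaussian s ν D) ↔
      Integrable F (densityMeasure (gaussianDensity (Sum.elim (b + B *ᵥ ν) ν)
        (fromBlocks (C * Cᵀ + B * D * Bᵀ) (B * D) (D * Bᵀ) D))) := by
  rw [← map_shear_baseGaussian b B hC]
  exact (integrable_map_measure hF.aestronglyMeasurable
    (continuous_shear b B C).measurable.aemeasurable).symm

theorem integral_comp_shear {b : s → ℝ} {B : Matrix s t ℝ} {C : Matrix s s ℝ}
    (hC : C.det ≠ 0) {ν : t → ℝ} {D : Matrix t t ℝ} {F : (s ⊕ t → ℝ) → ℝ} (hF : Measurable F) :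
    ∫ z, F (shear b B C z) ∂baseGaussian s ν D =
      ∫ z, F z ∂(densityMeasure (gaussianDensity (Sum.elim (b + B *ᵥ ν) ν)
        (fromBlocks (C * Cᵀ + B * D * Bᵀ) (B * D) (D * Bᵀ) D))) := by
  rw [← map_shear_baseGaussian b B hC, integral_map
    (continuous_shear b B C).measurable.aemeasurable hF.aestronglyMeasurable]

theorem isProbabilityMeasure_baseGaussian (ν : t → ℝ) {D : Matrix t t ℝ} (hD : D.PosDef) :
    IsProbabilityMeasure (baseGaussian s ν D) :=
  isProbabilityMeasure_gaussian _ (posDef_fromBlocks_one hD)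

theorem ae_baseGaussian_iff (ν : t → ℝ) {D : Matrix t t ℝ} (hD : D.PosDef)
    {P : (s ⊕ t → ℝ) → Prop} : (∀ᵐ z ∂baseGaussian s ν D, P z) ↔ ∀ᵐ z, P z :=
  ae_gaussian_iff _ (posDef_fromBlocks_one hD)

theorem ae_comp_shear (b : s → ℝ) (B : Matrix s t ℝ) {C : Matrix s s ℝ} (hC : C.det ≠ 0)
    {P : (s ⊕ t → ℝ) → Prop} (h : ∀ᵐ z, P z) : ∀ᵐ z, P (shear b B C z) := by
  have hd : (fromBlocks C B 0 (1 : Matrix t t ℝ)).det ≠ 0 := by rwa [det_shear]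
  have hq : Measure.QuasiMeasurePreserving (shear b B C) volume volume := by
    refine ⟨(continuous_shear b B C).measurable, ?_⟩
    rw [funext (shear_eq_affine b B C), map_volume_affine _ hd]
    exact Measure.smul_absolutelyContinuous
  exact hq.ae h

/-- The Gaussians in question are the images of the base Gaussian under shears, and their
divergence from `p` splits accordingly. -/
theorem toReal_gaussianKL_shear {p : (s ⊕ t → ℝ) → ℝ} (hm : Measurable p) (hp : ∀ z, 0 ≤ p z)
    (hint : ∫ z, p z = 1) (b : s → ℝ) (B : Matrix s t ℝ) {C : Matrix s s ℝ} (hC : C.det ≠ 0)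
    (ν : t → ℝ) {D : Matrix t t ℝ} (hD : D.PosDef) (hpos : ∀ᵐ z, 0 < p z)
    (hi : Integrable (fun z => Real.log (p (shear b B C z))) (baseGaussian s ν D)) :
    gaussianKL p (Sum.elim (b + B *ᵥ ν) ν)
        (fromBlocks (C * Cᵀ + B * D * Bᵀ) (B * D) (D * Bᵀ) D) ≠ ⊤ ∧
      (gaussianKL p (Sum.elim (b + B *ᵥ ν) ν)
        (fromBlocks (C * Cᵀ + B * D * Bᵀ) (B * D) (D * Bᵀ) D)).toReal =
      ∫ z, Real.log (gaussianDensity (Sum.elim 0 ν) (fromBlocks 1 0 0 D) z)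
        ∂baseGaussian s ν D - Real.log |C.det| -
      ∫ z, Real.log (p (shear b B C z)) ∂baseGaussian s ν D := by
  have hS := posDef_shear_cov B hC hD
  have hS0 : (fromBlocks (1 : Matrix s s ℝ) 0 0 D).PosDef := posDef_fromBlocks_one hD
  have hd : (fromBlocks C B 0 (1 : Matrix t t ℝ)).det ≠ 0 := by rwa [det_shear]
  have := isProbabilityMeasure_baseGaussian (s := s) ν hD
  have htop := (gaussianKL_ne_top_iff hm (Sum.elim (b + B *ᵥ ν) ν) hS).mpr
    ⟨hpos, (integrable_comp_shear_iff hC hm.log).mp hi⟩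
  refine ⟨htop, ?_⟩
  rw [toReal_gaussianKL hm hp hint _ hS htop, ← integral_comp_shear hC hm.log,
    ← integral_comp_shear hC (continuous_gaussianDensity _ _).measurable.log]
  congr 1
  -- Along the shear the Gaussian density is the base density divided by its Jacobian `|det C|`;
  -- this is the entropy term.
  have hlog : ∀ z, Real.log (gaussianDensity (Sum.elim (b + B *ᵥ ν) ν)
      (fromBlocks (C * Cᵀ + B * D * Bᵀ) (B * D) (D * Bᵀ) D) (shear b B C z)) =
      Real.log (gaussianDensity (Sum.elim 0 ν) (fromBlocks 1 0 0 D) z) - Real.log |C.det| := by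
    intro z
    have h := gaussianDensity_affine (S := fromBlocks 1 0 0 D) (Sum.elim 0 ν) (Sum.elim b 0) hd z
    rw [shear_cov, ← shear_eq_affine, ← shear_eq_affine, det_shear] at h
    have h0 : shear b B C (Sum.elim 0 ν) = Sum.elim (b + B *ᵥ ν) ν := by simp [shear]
    rw [h0] at h
    rw [← h, Real.log_mul (abs_pos.mpr hC).ne' (gaussianDensity_pos _ hS _).ne']
    ring
  simp_rw [hlog]
  have hi0 : Integrable (fun z => Real.log (gaussianDensity (Sum.elim 0 ν) (fromBlocks 1 0 0 D) z))
      (baseGaussian s ν D) := integrable_log_gaussianDensity _ hS0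
  rw [integral_sub hi0 (integrable_const _)]
  simp

theorem IsGaussianKLMinimizer.gaussianKL_ne_top {ι : Type*} [Fintype ι] [DecidableEq ι]
    {p : (ι → ℝ) → ℝ} {ν : ι → ℝ} {S : Matrix ι ι ℝ} (hmin : IsGaussianKLMinimizer p ν S)
    (hfin : ∃ (ν : ι → ℝ) (S : Matrix ι ι ℝ), S.PosDef ∧ gaussianKL p ν S ≠ ⊤) :
    gaussianKL p ν S ≠ ⊤ := by
  obtain ⟨ν', S', hS', h⟩ := hfin
  exact ne_top_of_le_ne_top h (hmin.2 ν' S' hS')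

variable {p : (s ⊕ t → ℝ) → ℝ} {ν : s ⊕ t → ℝ} {S : Matrix (s ⊕ t) (s ⊕ t) ℝ}

theorem IsGaussianKLMinimizer.integrable_shear (hm : Measurable p)
    (hmin : IsGaussianKLMinimizer p ν S) (htop : gaussianKL p ν S ≠ ⊤)
    {b : s → ℝ} {B : Matrix s t ℝ} {C : Matrix s s ℝ} (hC0 : C.det ≠ 0)
    (hb : ∀ y, b + B *ᵥ y = condLoc ν S y) (hC : C * Cᵀ = condScale S) :
    Integrable (fun z => Real.log (p (shear b B C z)))
      (baseGaussian s (ν ∘ Sum.inr) S.toBlocks₂₂) := by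
  obtain ⟨hν, hS⟩ := shear_params hmin.1 hb hC
  rw [integrable_comp_shear_iff hC0 hm.log, hν, hS]
  exact ((gaussianKL_ne_top_iff hm ν hmin.1).mp htop).2

/-- Among the Gaussians with the same marginal in the last block, a minimizer maximizes the
expected log density plus the entropy. -/
theorem IsGaussianKLMinimizer.shear_le (hm : Measurable p) (hp : ∀ z, 0 ≤ p z)
    (hint : ∫ z, p z = 1) (hmin : IsGaussianKLMinimizer p ν S) (htop : gaussianKL p ν S ≠ ⊤)
    {b b' : s → ℝ} {B B' : Matrix s t ℝ} {C C' : Matrix s s ℝ} (hC0 : C.det ≠ 0)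
    (hb : ∀ y, b + B *ᵥ y = condLoc ν S y) (hC : C * Cᵀ = condScale S) (hC0' : C'.det ≠ 0)
    (hi' : Integrable (fun z => Real.log (p (shear b' B' C' z)))
      (baseGaussian s (ν ∘ Sum.inr) S.toBlocks₂₂)) :
    Real.log |C'.det| + ∫ z, Real.log (p (shear b' B' C' z))
        ∂baseGaussian s (ν ∘ Sum.inr) S.toBlocks₂₂ ≤
      Real.log |C.det| + ∫ z, Real.log (p (shear b B C z))
        ∂baseGaussian s (ν ∘ Sum.inr) S.toBlocks₂₂ := by
  have hD : S.toBlocks₂₂.PosDef :=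
    hmin.1.submatrix (e := (Sum.inr : t → s ⊕ t)) Sum.inr_injective
  have hpos := ((gaussianKL_ne_top_iff hm ν hmin.1).mp htop).1
  have hi := hmin.integrable_shear hm htop hC0 hb hC
  obtain ⟨hν, hS⟩ := shear_params hmin.1 hb hC
  obtain ⟨h1, h2⟩ := toReal_gaussianKL_shear hm hp hint b B hC0 (ν ∘ Sum.inr) hD hpos hi
  obtain ⟨h1', h2'⟩ := toReal_gaussianKL_shear hm hp hint b' B' hC0' (ν ∘ Sum.inr) hD hpos hi'
  rw [hν, hS] at h1 h2
  have := ENNReal.toReal_mono h1' (hmin.2 _ _ (posDef_shear_cov B' hC0' hD))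
  rw [h2, h2'] at this
  linarith

/-- Divided by its integral, `p ∘ shear` is itself a probability density, so the one-sided criterion
`integrable_log_of_le` applies to it under the base Gaussian. -/
theorem integrable_log_shear_of_le (hm : Measurable p)
    (hint : ∫ z, p z = 1) (hpos : ∀ᵐ z, 0 < p z) {ν : t → ℝ} {D : Matrix t t ℝ} (hD : D.PosDef)
    {b : s → ℝ} {B : Matrix s t ℝ} {C : Matrix s s ℝ} (hC : C.det ≠ 0)
    {G : (s ⊕ t → ℝ) → ℝ} (hG : Integrable G (baseGaussian s ν D))
    (hle : ∀ᵐ z, G z ≤ Real.log (p (shear b B C z))) :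
    Integrable (fun z => Real.log (p (shear b B C z))) (baseGaussian s ν D) := by
  have := isProbabilityMeasure_baseGaussian (s := s) ν hD
  have hm' := (continuous_shear b B C).measurable
  have hd : (fromBlocks C B 0 (1 : Matrix t t ℝ)).det ≠ 0 := by rwa [det_shear]
  have hq : Integrable (fun z => p (shear b B C z)) := by
    have hpi : Integrable p := integrable_of_integral_eq_one hint
    have h2 : Integrable p (Measure.map (shear b B C) volume) := by
      rw [funext (shear_eq_affine b B C), map_volume_affine _ hd]
      exact hpi.smul_measure ENNReal.ofReal_ne_top
    exact h2.comp_measurable hm'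
  have hpos' := ae_comp_shear b B hC hpos
  have hqint : 0 < ∫ z, p (shear b B C z) := by
    refine (integral_pos_iff_support_of_nonneg_ae ?_ hq).mpr ?_
    · filter_upwards [hpos'] with z hz using hz.le
    · have : Function.support (fun z => p (shear b B C z)) =ᵐ[volume] Set.univ := by
        filter_upwards [hpos'] with z hz
        exact propext ⟨fun _ => trivial, fun _ => hz.ne'⟩
      rw [measure_congr this]
      exact isOpen_univ.measure_pos _ Set.univ_nonempty
  set c := ∫ z, p (shear b B C z) with hc
  have key := integrable_log_of_le (p := fun z => p (shear b B C z) / c)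
    ((hm.comp hm').div_const c) (by rw [integral_div, ← hc, div_self hqint.ne'])
    (by filter_upwards [hpos'] with z hz using div_pos hz hqint) _ (posDef_fromBlocks_one hD)
    (G := fun z => G z - Real.log c) (Integrable.sub (μ := baseGaussian s ν D) hG
      (integrable_const _)) (by
      filter_upwards [hle, hpos'] with z hz hz'
      rw [Real.log_div hz'.ne' hqint.ne']
      linarith)
  refine (Integrable.add (μ := baseGaussian s ν D) key (integrable_const (Real.log c))).congr ?_
  refine (ae_baseGaussian_iff ν hD).mpr ?_
  filter_upwards [hpos'] with z hz'
  simp [Real.log_div hz'.ne' hqint.ne']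

end Shear

/-! ### Null sets, integrability and the splitting into blocks -/

section Fubini

variable {s t : Type*} [Fintype s] [Fintype t]

theorem measurePreserving_sumElim :
    MeasurePreserving (fun z : (t → ℝ) × (s → ℝ) => (Sum.elim z.2 z.1 : s ⊕ t → ℝ)) := by
  have h1 := (volume_measurePreserving_sumPiEquivProdPi (fun _ : s ⊕ t => ℝ)).symm
  exact h1.comp Measure.measurePreserving_swap

theorem ae_ae_sumElim {P : (s ⊕ t → ℝ) → Prop} (h : ∀ᵐ z, P z) :
    ∀ᵐ y : t → ℝ, ∀ᵐ x : s → ℝ, P (Sum.elim x y) :=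
  Measure.ae_ae_of_ae_prod (measurePreserving_sumElim.quasiMeasurePreserving.ae h)

theorem ae_comp_inr {P : (t → ℝ) → Prop} (h : ∀ᵐ y, P y) :
    ∀ᵐ z : s ⊕ t → ℝ, P (z ∘ Sum.inr) := by
  have h1 := volume_measurePreserving_sumPiEquivProdPi (fun _ : s ⊕ t => ℝ)
  exact (Measure.quasiMeasurePreserving_snd.comp h1.quasiMeasurePreserving).ae h

theorem ae_integrable_sumElim {F : (s ⊕ t → ℝ) → ℝ} (h : Integrable F) :
    ∀ᵐ y : t → ℝ, Integrable fun x : s → ℝ => F (Sum.elim x y) :=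
  Integrable.prod_right_ae (measurePreserving_sumElim.integrable_comp_of_integrable h)

theorem ae_marginal_pos {p : (s ⊕ t → ℝ) → ℝ} (hi : Integrable p) (hpos : ∀ᵐ z, 0 < p z) :
    ∀ᵐ y, 0 < marginal p y := by
  filter_upwards [ae_integrable_sumElim hi, ae_ae_sumElim hpos] with y h1 h2
  refine (integral_pos_iff_support_of_nonneg_ae ?_ h1).mpr ?_
  · filter_upwards [h2] with z hz using hz.le
  · have : Function.support (fun x => p (Sum.elim x y)) =ᵐ[volume] Set.univ := by
      filter_upwards [h2] with z hz
      exact propext ⟨fun _ => trivial, fun _ => hz.ne'⟩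
    rw [measure_congr this]
    exact isOpen_univ.measure_pos _ Set.univ_nonempty

end Fubini

/-! ### Factorizations of positive definite matrices -/

section LinearAlgebra

variable {ι : Type*} [Fintype ι] [DecidableEq ι]

open scoped MatrixOrder in
theorem exists_mul_transpose_eq {M : Matrix ι ι ℝ} (hM : M.PosDef) :
    ∃ P : Matrix ι ι ℝ, P.det ≠ 0 ∧ P * Pᵀ = M := by
  obtain ⟨C, hC⟩ := CStarAlgebra.nonneg_iff_eq_star_mul_self.mp hM.posSemidef.nonneg
  have hC' : Cᵀ * Cᵀᵀ = M := by rw [hC]; simp [star_eq_conjTranspose]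
  refine ⟨Cᵀ, fun h => ?_, hC'⟩
  have := hM.det_pos
  rw [← hC', det_mul, h] at this
  simp at this

/-- Two positive definite quadratic forms can be diagonalized simultaneously. -/
theorem exists_simultaneous_diagonalization {M T : Matrix ι ι ℝ} (hM : M.PosDef)
    (hT : T.PosDef) : ∃ (P : Matrix ι ι ℝ) (d : ι → ℝ), P.det ≠ 0 ∧ (∀ i, 0 < d i) ∧
      P * Pᵀ = M ∧ (P * diagonal d) * (P * diagonal d)ᵀ = T := by
  obtain ⟨R, hR, hRM⟩ := exists_mul_transpose_eq hM
  have hRu : IsUnit R.det := hR.isUnit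
  have hW : (R⁻¹ * T * R⁻¹ᵀ).PosDef := by
    have hu : IsUnit R⁻¹ := by
      rw [isUnit_iff_isUnit_det]; exact isUnit_nonsing_inv_det R hRu
    have := (IsUnit.posDef_star_right_conjugate_iff (x := T) hu).mpr hT
    simpa [star_eq_conjTranspose] using this
  set U : Matrix ι ι ℝ := (hW.isHermitian.eigenvectorUnitary : Matrix ι ι ℝ) with hU
  have hUU : U * Uᵀ = 1 := by
    have := (Matrix.mem_unitaryGroup_iff).mp hW.isHermitian.eigenvectorUnitary.2
    simpa [star_eq_conjTranspose] using this
  have hspec : R⁻¹ * T * R⁻¹ᵀ = U * diagonal hW.isHermitian.eigenvalues * Uᵀ := by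
    have := hW.isHermitian.spectral_theorem
    rw [Unitary.conjStarAlgAut_apply] at this
    simpa [star_eq_conjTranspose, Function.comp_def] using this
  -- `R` whitens `M`, and the orthogonal `U` diagonalizes the whitened `T`; inserting `U` does not
  -- change `R * Rᵀ = M`.
  refine ⟨R * U, fun i => √(hW.isHermitian.eigenvalues i), ?_,
    fun i => Real.sqrt_pos.mpr (hW.eigenvalues_pos i), ?_, ?_⟩
  · rw [det_mul]
    refine mul_ne_zero hR fun h => ?_
    have := congrArg det hUU
    rw [det_mul, h] at this
    simp at this
  · rw [transpose_mul, Matrix.mul_assoc, ← Matrix.mul_assoc U, hUU, Matrix.one_mul, hRM]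
  · have hd : diagonal (fun i => √(hW.isHermitian.eigenvalues i)) *
        (diagonal fun i => √(hW.isHermitian.eigenvalues i))ᵀ =
        diagonal hW.isHermitian.eigenvalues := by
      rw [diagonal_transpose, diagonal_mul_diagonal]
      congr 1
      ext i
      exact Real.mul_self_sqrt (hW.eigenvalues_pos i).le
    calc _ = R * (U * (diagonal (fun i => √(hW.isHermitian.eigenvalues i)) *
        (diagonal fun i => √(hW.isHermitian.eigenvalues i))ᵀ) * Uᵀ) * Rᵀ := by
          simp only [transpose_mul, Matrix.mul_assoc]
      _ = R * (R⁻¹ * T * R⁻¹ᵀ) * Rᵀ := by rw [hd, ← hspec]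
      _ = (R * R⁻¹) * T * (R * R⁻¹)ᵀ := by simp only [transpose_mul, Matrix.mul_assoc]
      _ = T := by rw [mul_nonsing_inv _ hRu]; simp

theorem mahalanobis_add_mulVec {P M : Matrix ι ι ℝ} (hP : P.det ≠ 0) (hM : P * Pᵀ = M)
    (c u : ι → ℝ) : mahalanobis M c (c + P *ᵥ u) = √(u ⬝ᵥ u) := by
  have hPu : IsUnit P.det := hP.isUnit
  rw [mahalanobis, add_sub_cancel_left, ← hM, Matrix.mul_inv_rev, ← mulVec_mulVec, mulVec_mulVec u,
    nonsing_inv_mul _ hPu, one_mulVec, ← transpose_nonsing_inv, dotProduct_mulVec,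
    vecMul_transpose, mulVec_mulVec, nonsing_inv_mul _ hPu, one_mulVec]

end LinearAlgebra

/-! ### Elliptical symmetry in whitened coordinates -/

section Radial

variable {ι : Type*} [Fintype ι] [DecidableEq ι]

theorem IsEllipticallySymmetric.eq_of_dotProduct_eq {ρ : (ι → ℝ) → ℝ} {m : ι → ℝ}
    {M P : Matrix ι ι ℝ} (h : IsEllipticallySymmetric ρ m M) (hP : P.det ≠ 0) (hM : P * Pᵀ = M)
    {u v : ι → ℝ} (huv : u ⬝ᵥ u = v ⬝ᵥ v) : ρ (m + P *ᵥ u) = ρ (m + P *ᵥ v) :=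
  h.eq_of_mahalanobis_eq _ _ (by
    rw [mahalanobis_add_mulVec hP hM, mahalanobis_add_mulVec hP hM, huv])

theorem IsEllipticallySymmetric.reflect {ρ : (ι → ℝ) → ℝ} {m : ι → ℝ}
    {M : Matrix ι ι ℝ} (h : IsEllipticallySymmetric ρ m M) (v : ι → ℝ) :
    ρ (m - v) = ρ (m + v) :=
  h.eq_of_mahalanobis_eq _ _ (by simp [mahalanobis, mulVec_neg])

end Radial

/-! ### Midpoint inequalities for log-concave functions -/

section LogConcave

variable {ι : Type*} [Fintype ι] {ρ : (ι → ℝ) → ℝ}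

theorem SomewhereStrictlyLogConcave.log_le (h : SomewhereStrictlyLogConcave ρ)
    (hpos : ∀ x, 0 < ρ x) (x y : ι → ℝ) {a b : ℝ} (ha : 0 ≤ a) (hb : 0 ≤ b) (hab : a + b = 1) :
    a * Real.log (ρ x) + b * Real.log (ρ y) ≤ Real.log (ρ (a • x + b • y)) := by
  have h1 := h.logConcave x y a b ha hb hab
  have hx := hpos x
  have hy := hpos y
  have := Real.log_le_log (by positivity) h1
  rwa [Real.log_mul (by positivity) (by positivity), Real.log_rpow hx, Real.log_rpow hy] at this

theorem SomewhereStrictlyLogConcave.log_midpoint_le (h : SomewhereStrictlyLogConcave ρ)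
    (hpos : ∀ x, 0 < ρ x) {x y z : ι → ℝ} (hz : z + z = x + y) :
    (Real.log (ρ x) + Real.log (ρ y)) / 2 ≤ Real.log (ρ z) := by
  have h1 := h.log_le hpos x y (a := 1 / 2) (b := 1 / 2) (by norm_num) (by norm_num) (by norm_num)
  have hz' : z = (1 / 2 : ℝ) • x + (1 / 2 : ℝ) • y := by
    rw [← smul_add, ← hz, ← two_smul ℝ z, smul_smul]; norm_num
  rw [hz']
  linarith

/-- Strictness is known only inside `U`, while `c` may be long. For small `τ` the points `x ± τ c`
lie in `U` and give a strict inequality; concavity on the segments from `x` to `x ± c` carries it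
over to `x ± c`. -/
theorem SomewhereStrictlyLogConcave.exists_open_log_lt (h : SomewhereStrictlyLogConcave ρ)
    (hpos : ∀ x, 0 < ρ x) {c : ι → ℝ} (hc : c ≠ 0) :
    ∃ U : Set (ι → ℝ), IsOpen U ∧ U.Nonempty ∧ ∀ x ∈ U,
      (Real.log (ρ (x + c)) + Real.log (ρ (x - c))) / 2 < Real.log (ρ x) := by
  obtain ⟨U, hU, hne, -, hs⟩ := h.strict
  refine ⟨U, hU, hne, fun x hx => ?_⟩
  have hev : ∀ᶠ τ : ℝ in nhds 0, x + τ • c ∈ U ∧ x - τ • c ∈ U := by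
    have h1 : Filter.Tendsto (fun τ : ℝ => x + τ • c) (nhds 0) (nhds x) := by
      have : Continuous fun τ : ℝ => x + τ • c := by fun_prop
      simpa using this.tendsto 0
    have h2 : Filter.Tendsto (fun τ : ℝ => x - τ • c) (nhds 0) (nhds x) := by
      have : Continuous fun τ : ℝ => x - τ • c := by fun_prop
      simpa using this.tendsto 0
    exact (h1.eventually (hU.mem_nhds hx)).and (h2.eventually (hU.mem_nhds hx))
  have hev2 : ∀ᶠ τ : ℝ in nhdsWithin 0 (Set.Ioi 0), τ < 1 :=
    nhdsWithin_le_nhds (gt_mem_nhds one_pos)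
  obtain ⟨τ, ⟨⟨h1, h2⟩, h3⟩, h4⟩ :=
    (((hev.filter_mono nhdsWithin_le_nhds).and hev2).and self_mem_nhdsWithin).exists
  have hτ : 0 < τ := h4
  have hne : x + τ • c ≠ x - τ • c := by
    intro he
    have : (2 * τ) • c = 0 := by
      have h5 : x + τ • c - (x - τ • c) = 0 := sub_eq_zero.mpr he
      rw [← h5, two_mul, add_smul]; abel
    rcases smul_eq_zero.mp this with h6 | h6
    · linarith
    · exact hc h6
  have h5 := hs _ h1 _ h2 hne (1 / 2) (1 / 2) (by norm_num) (by norm_num) (by norm_num)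
  have e0 : (1 / 2 : ℝ) • (x + τ • c) + (1 / 2 : ℝ) • (x - τ • c) = x := by
    rw [← smul_add, add_add_sub_cancel, ← two_smul ℝ x, smul_smul]; norm_num
  rw [e0] at h5
  have p1 := hpos (x + τ • c)
  have p2 := hpos (x - τ • c)
  have h6 := Real.log_lt_log (by positivity) h5
  rw [Real.log_mul (by positivity) (by positivity), Real.log_rpow p1, Real.log_rpow p2] at h6
  have h7 := h.log_le hpos x (x + c) (a := 1 - τ) (b := τ) (by linarith) hτ.le (by ring)
  have h8 := h.log_le hpos x (x - c) (a := 1 - τ) (b := τ) (by linarith) hτ.le (by ring)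
  have e1 : (1 - τ) • x + τ • (x + c) = x + τ • c := by
    rw [smul_add, ← add_assoc, ← add_smul, sub_add_cancel, one_smul]
  have e2 : (1 - τ) • x + τ • (x - c) = x - τ • c := by
    rw [smul_sub, ← add_sub_assoc, ← add_smul, sub_add_cancel, one_smul]
  rw [e1] at h7
  rw [e2] at h8
  have : 0 < τ * (2 * Real.log (ρ x) - (Real.log (ρ (x + c)) + Real.log (ρ (x - c)))) := by
    nlinarith
  have := pos_of_mul_pos_right this hτ.le
  linarith

end LogConcave

/-! ### Decay and moments of radial log-concave functions -/

section Affine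

variable {ι : Type*} [Fintype ι] [DecidableEq ι]

theorem integral_affine {F : (ι → ℝ) → ℝ} (hF : Measurable F) (b : ι → ℝ) {K : Matrix ι ι ℝ}
    (hK : K.det ≠ 0) : ∫ z, F (b + K *ᵥ z) = |K.det|⁻¹ * ∫ z, F z := by
  have hm : Measurable fun z : ι → ℝ => b + K *ᵥ z := Continuous.measurable (by fun_prop)
  rw [← integral_map hm.aemeasurable hF.aestronglyMeasurable, map_volume_affine b hK,
    integral_smul_measure, ENNReal.toReal_ofReal (by positivity), smul_eq_mul]

end Affine

section Decay

variable {ι : Type*} [Fintype ι] [DecidableEq ι] {h : (ι → ℝ) → ℝ}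

theorem norm_le_sqrt_dotProduct_self (u : ι → ℝ) : ‖u‖ ≤ √(u ⬝ᵥ u) := by
  refine (pi_norm_le_iff_of_nonneg (Real.sqrt_nonneg _)).mpr fun i => ?_
  refine Real.le_sqrt_of_sq_le ?_
  rw [Real.norm_eq_abs, sq_abs, sq]
  exact Finset.single_le_sum (f := fun i => u i * u i) (fun i _ => mul_self_nonneg _)
    (Finset.mem_univ i)

/-- A nonconstant radial log-concave function decays exponentially. -/
theorem SomewhereStrictlyLogConcave.exists_exp_decay [Nonempty ι]
    (hl : SomewhereStrictlyLogConcave h) (hpos : ∀ u, 0 < h u)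
    (hrad : ∀ u v : ι → ℝ, u ⬝ᵥ u = v ⬝ᵥ v → h u = h v) :
    ∃ a b : ℝ, 0 < b ∧ ∀ u, h u ≤ Real.exp (a - b * ‖u‖) := by
  -- Symmetry and the midpoint inequality give `h x ≤ h 0` everywhere. If equality always held, `h`
  -- would be constant, contrary to strict log concavity somewhere.
  have hx : ∃ x, h x < h 0 := by
    by_contra! hcon
    have hconst : ∀ x, h x = h 0 := by
      intro x
      refine le_antisymm ?_ (hcon x)
      have h1 := hl.log_midpoint_le hpos (x := x) (y := -x) (z := 0) (by simp)
      rw [hrad (-x) x (by simp)] at h1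
      exact (Real.log_le_log_iff (hpos x) (hpos 0)).mp (by linarith)
    obtain ⟨U, -, ⟨x, hx⟩, hs⟩ := hl.exists_open_log_lt hpos (c := fun _ => (1 : ℝ))
      (fun hc => by simpa using congrFun hc (Classical.arbitrary ι))
    have := hs x hx
    rw [hconst (_ + _), hconst (_ - _), hconst x] at this
    linarith
  obtain ⟨x, hx⟩ := hx
  have hx0 : x ≠ 0 := by rintro rfl; exact lt_irrefl _ hx
  have hxx : 0 < x ⬝ᵥ x := by
    refine lt_of_le_of_ne (by simpa using dotProduct_star_self_nonneg x) fun he => ?_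
    exact hx0 (dotProduct_self_eq_zero.mp he.symm)
  set r₀ := √(x ⬝ᵥ x) with hr₀
  have hr₀pos : 0 < r₀ := Real.sqrt_pos.mpr hxx
  set δ := Real.log (h 0) - Real.log (h x) with hδ
  have hδpos : 0 < δ := sub_pos.mpr (Real.log_lt_log (hpos x) hx)
  -- `δ` is the drop of `log h` from radius `0` to `r₀`, and concavity keeps at least this slope
  -- beyond `r₀`. The extra `δ` in the intercept makes the bound valid inside the ball too.
  refine ⟨Real.log (h 0) + δ, δ / r₀, by positivity, fun u => ?_⟩
  have hlog : Real.log (h u) ≤ Real.log (h 0) + δ - δ / r₀ * √(u ⬝ᵥ u) := by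
    set r := √(u ⬝ᵥ u) with hr
    have hr0 : 0 ≤ r := Real.sqrt_nonneg _
    have huu : 0 ≤ u ⬝ᵥ u := by simpa using dotProduct_star_self_nonneg u
    rcases le_or_gt r r₀ with hle | hgt
    · have h0 := hl.log_midpoint_le hpos (x := u) (y := -u) (z := 0) (by simp)
      rw [hrad (-u) u (by simp)] at h0
      have : δ / r₀ * r ≤ δ := by
        rw [div_mul_eq_mul_div, div_le_iff₀ hr₀pos]
        gcongr
      linarith
    · have hrpos : 0 < r := hr₀pos.trans hgt
      have hu : h u = h ((r / r₀) • x) := by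
        refine hrad _ _ ?_
        rw [smul_dotProduct, dotProduct_smul, smul_eq_mul, smul_eq_mul, ← mul_assoc,
          div_mul_div_comm, hr, hr₀, Real.mul_self_sqrt huu, Real.mul_self_sqrt hxx.le,
          div_mul_cancel₀ _ hxx.ne']
      -- `x`, at radius `r₀`, is a convex combination of the origin and the point of radius `r` in
      -- its direction.
      have h1 := hl.log_le hpos 0 ((r / r₀) • x) (a := 1 - r₀ / r) (b := r₀ / r)
        (by rw [sub_nonneg, div_le_one hrpos]; exact hgt.le) (by positivity) (by ring)
      rw [smul_zero, zero_add, smul_smul, div_mul_div_comm, mul_comm r₀ r,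
        div_self (by positivity), one_smul, ← hu] at h1
      have h2 : r₀ / r * Real.log (h u) ≤ r₀ / r * (Real.log (h 0) - δ / r₀ * r) := by
        have : r₀ / r * (Real.log (h 0) - δ / r₀ * r) = r₀ / r * Real.log (h 0) - δ := by
          field_simp
        rw [this]
        linarith
      have := le_of_mul_le_mul_left h2 (by positivity)
      linarith
  rw [← Real.exp_log (hpos u)]
  refine Real.exp_le_exp.mpr (hlog.trans ?_)
  have := norm_le_sqrt_dotProduct_self u
  gcongr

theorem integrable_sq_mul_of_exp_decay (hm : Measurable h) (hpos : ∀ u, 0 ≤ h u) {a b : ℝ}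
    (hb : 0 < b) (hle : ∀ u, h u ≤ Real.exp (a - b * ‖u‖)) :
    Integrable fun u => (1 + ‖u‖) ^ 2 * h u := by
  set n := Module.finrank ℝ (ι → ℝ)
  have hi := integrable_one_add_norm (E := ι → ℝ) (μ := volume) (r := ((n + 1 : ℕ) : ℝ))
    (by push_cast; linarith)
  refine (hi.const_mul (((n + 3).factorial : ℝ) / b ^ (n + 3) * Real.exp (a + b))).mono'
    (by fun_prop) (Filter.Eventually.of_forall fun u => ?_)
  -- Of the `n + 3` powers of `1 + ‖u‖`, two absorb the weight and `n + 1` make the majorant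
  -- integrable in dimension `n`.
  have h1 := Real.pow_div_factorial_le_exp (x := b * (1 + ‖u‖)) (by positivity) (n + 3)
  have hu : 0 < 1 + ‖u‖ := by positivity
  rw [Real.norm_eq_abs, abs_of_nonneg (mul_nonneg (by positivity) (hpos u)), Real.rpow_neg hu.le,
    Real.rpow_natCast]
  have h2 : Real.exp (a - b * ‖u‖) * Real.exp (b * (1 + ‖u‖)) = Real.exp (a + b) := by
    rw [← Real.exp_add]; ring_nf
  rw [div_le_iff₀ (by positivity)] at h1
  have hE := Real.exp_pos (a - b * ‖u‖)
  rw [← div_eq_mul_inv, le_div_iff₀ (by positivity), div_mul_eq_mul_div, le_div_iff₀ (by positivity),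
    ← h2]
  calc _ = h u * (b * (1 + ‖u‖)) ^ (n + 3) := by rw [mul_pow]; ring
    _ ≤ Real.exp (a - b * ‖u‖) * (b * (1 + ‖u‖)) ^ (n + 3) := by
        gcongr
        exact hle u
    _ ≤ Real.exp (a - b * ‖u‖) * (Real.exp (b * (1 + ‖u‖)) * (n + 3).factorial) := by gcongr
    _ = _ := by ring

theorem integrable_mul_of_abs_le {g : (ι → ℝ) → ℝ} (hg : Measurable g) (hm : Measurable h)
    (hpos : ∀ u, 0 ≤ h u) (hi : Integrable fun u => (1 + ‖u‖) ^ 2 * h u)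
    (hle : ∀ u, |g u| ≤ (1 + ‖u‖) ^ 2) : Integrable fun u => g u * h u := by
  refine hi.mono' (hg.mul hm).aestronglyMeasurable (Filter.Eventually.of_forall fun u => ?_)
  rw [Real.norm_eq_abs, abs_mul, abs_of_nonneg (hpos u)]
  exact mul_le_mul_of_nonneg_right (hle u) (hpos u)

end Decay

section Isotropic

variable {ι : Type*} [Fintype ι] [DecidableEq ι] {h : (ι → ℝ) → ℝ}

/-- An orthogonal map preserves both Lebesgue measure and the radial weight `h`. -/
theorem integral_orthogonal (hm : Measurable h)
    (hrad : ∀ u v : ι → ℝ, u ⬝ᵥ u = v ⬝ᵥ v → h u = h v) {Q : Matrix ι ι ℝ} (hQ : Qᵀ * Q = 1)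
    {g : (ι → ℝ) → ℝ} (hg : Measurable g) :
    ∫ u, g (Q *ᵥ u) * h u = ∫ u, g u * h u := by
  have hd : |Q.det| = 1 := by
    have := congrArg det hQ
    rw [det_mul, det_transpose, det_one, mul_self_eq_one_iff] at this
    rcases this with h | h <;> simp [h]
  have hd0 : Q.det ≠ 0 := by rintro h; simp [h] at hd
  have h1 := integral_affine (hg.mul hm) 0 hd0
  rw [hd, inv_one, one_mul] at h1
  rw [show (∫ u, g u * h u) = ∫ u, (g * h) u from rfl, ← h1]
  refine integral_congr_ae (Filter.Eventually.of_forall fun u => ?_)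
  simp only [zero_add, Pi.mul_apply]
  congr 1
  refine hrad _ _ ?_
  rw [dotProduct_mulVec, ← mulVec_transpose, mulVec_mulVec, hQ, one_mulVec]

/-- The second moments of a radial function are a multiple of the identity matrix. -/
theorem exists_second_moment_eq [Nonempty ι] (hm : Measurable h) (hpos : ∀ u, 0 < h u)
    (hrad : ∀ u v : ι → ℝ, u ⬝ᵥ u = v ⬝ᵥ v → h u = h v)
    (hi : Integrable fun u => (1 + ‖u‖) ^ 2 * h u) :
    ∃ κ : ℝ, 0 < κ ∧ ∀ k l, ∫ u, u k * u l * h u = κ * (1 : Matrix ι ι ℝ) k l := by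
  have hmeas : ∀ k l, Measurable fun u : ι → ℝ => u k * u l := fun k l => by fun_prop
  set k₀ := Classical.arbitrary ι
  refine ⟨∫ u, u k₀ * u k₀ * h u, ?_, fun k l => ?_⟩
  · have hle : ∀ u : ι → ℝ, |u k₀ * u k₀| ≤ (1 + ‖u‖) ^ 2 := fun u => by
      have := norm_le_pi_norm u k₀
      rw [Real.norm_eq_abs] at this
      rw [abs_mul]
      nlinarith [abs_nonneg (u k₀), norm_nonneg u]
    refine (integral_pos_iff_support_of_nonneg
      (fun u => mul_nonneg (mul_self_nonneg _) (hpos u).le)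
      (integrable_mul_of_abs_le (hmeas _ _) hm (fun u => (hpos u).le) hi hle)).mpr ?_
    have : Function.support (fun u => u k₀ * u k₀ * h u) = {u | u k₀ ≠ 0} := by
      ext u
      simp [(hpos u).ne']
    rw [this]
    refine IsOpen.measure_pos _ (isOpen_ne_fun (by fun_prop) (by fun_prop)) ⟨fun _ => 1, by simp⟩
  · by_cases hkl : k = l
    · subst hkl
      rw [one_apply_eq, mul_one]
      -- Exchanging two coordinates shows that all diagonal moments agree.
      have hQ : ((Equiv.swap k k₀).permMatrix ℝ)ᵀ * (Equiv.swap k k₀).permMatrix ℝ = 1 := by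
        rw [transpose_permMatrix, ← permMatrix_mul]; simp
      have := integral_orthogonal hm hrad hQ (hmeas k₀ k₀)
      simp only [permMatrix_mulVec, Function.comp, Equiv.swap_apply_right] at this
      exact this
    · rw [one_apply_ne hkl, mul_zero]
      -- Flipping the sign of coordinate `k` alone negates the mixed moment, which therefore
      -- vanishes.
      set d : ι → ℝ := Function.update 1 k (-1)
      have hQ : (diagonal d)ᵀ * diagonal d = 1 := by
        rw [diagonal_transpose, diagonal_mul_diagonal, ← diagonal_one]
        congr 1
        ext i
        by_cases hik : i = k
        · subst hik; simp [d]
        · simp [d, hik]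
      have := integral_orthogonal hm hrad hQ (hmeas k l)
      simp only [mulVec_diagonal] at this
      have hdl : d l = 1 := by simp [d, Ne.symm hkl]
      have hdk : d k = -1 := by simp [d]
      simp only [hdl, hdk, neg_mul, one_mul, integral_neg] at this
      linarith

end Isotropic

/-! ### Mean and covariance of an elliptical log-concave density -/

section Moments

variable {ι : Type*} [Fintype ι] [DecidableEq ι] [Nonempty ι] {ρ : (ι → ℝ) → ℝ} {m : ι → ℝ}
  {M : Matrix ι ι ℝ}

theorem SomewhereStrictlyLogConcave.comp_affine (hl : SomewhereStrictlyLogConcave ρ) (m : ι → ℝ)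
    {P : Matrix ι ι ℝ} (hP : P.det ≠ 0) :
    SomewhereStrictlyLogConcave fun u => ρ (m + P *ᵥ u) := by
  have hPu : IsUnit P.det := hP.isUnit
  have key : ∀ x y : ι → ℝ, ∀ a b : ℝ, a + b = 1 →
      m + P *ᵥ (a • x + b • y) = a • (m + P *ᵥ x) + b • (m + P *ᵥ y) := by
    intro x y a b hab
    rw [mulVec_add, mulVec_smul, mulVec_smul, smul_add, smul_add, add_add_add_comm, ← add_smul, hab,
      one_smul]
  refine ⟨fun u => hl.nonneg _, fun x y a b ha hb hab => ?_, ?_⟩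
  · simp only [key x y a b hab]
    exact hl.logConcave _ _ a b ha hb hab
  · obtain ⟨U, hU, ⟨z, hz⟩, hc, hs⟩ := hl.strict
    refine ⟨(fun u => m + P *ᵥ u) ⁻¹' U, hU.preimage (by fun_prop), ⟨P⁻¹ *ᵥ (z - m), ?_⟩, ?_, ?_⟩
    · simp only [Set.mem_preimage]
      rwa [mulVec_mulVec, mul_nonsing_inv _ hPu, one_mulVec, add_sub_cancel]
    · intro x hx y hy a b ha hb hab
      simp only [Set.mem_preimage] at *
      rw [key x y a b hab]
      exact hc hx hy ha hb hab
    · intro x hx y hy hxy a b ha hb hab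
      simp only [key x y a b hab]
      refine hs _ hx _ hy (fun he => hxy ?_) a b ha hb hab
      exact mulVec_injective_of_isUnit ((isUnit_iff_isUnit_det P).mpr hPu) (add_left_cancel he)

/-- In coordinates `x = m + P u` with `P * Pᵀ = M` the density is radial with exponential decay. Its
first moments vanish by `u ↦ -u`, its second moments are a multiple of the identity, and `P` turns
the identity into `M`. The Jacobian `|det P|` enters the factor. -/
theorem SomewhereStrictlyLogConcave.moments (hl : SomewhereStrictlyLogConcave ρ)
    (hm : Measurable ρ) (hpos : ∀ x, 0 < ρ x) (hell : IsEllipticallySymmetric ρ m M)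
    (hint : ∫ x, ρ x = 1) :
    (∀ i, ∫ x, x i * ρ x = m i) ∧
      ∃ κ : ℝ, 0 < κ ∧ ∀ i j, ∫ x, (x i - m i) * (x j - m j) * ρ x = κ * M i j := by
  obtain ⟨P, hP, hPM⟩ := exists_mul_transpose_eq hell.posDef
  have hPu : IsUnit P.det := hP.isUnit
  set h : (ι → ℝ) → ℝ := fun u => ρ (m + P *ᵥ u) with hh
  have hT : Measurable fun u : ι → ℝ => m + P *ᵥ u := Continuous.measurable (by fun_prop)
  have hhm : Measurable h := hm.comp hT
  have hhpos : ∀ u, 0 < h u := fun u => hpos _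
  have hrad : ∀ u v : ι → ℝ, u ⬝ᵥ u = v ⬝ᵥ v → h u = h v :=
    fun u v huv => hell.eq_of_dotProduct_eq hP hPM huv
  obtain ⟨a, b, hb, hdec⟩ := (hl.comp_affine m hP).exists_exp_decay hhpos hrad
  have hi := integrable_sq_mul_of_exp_decay hhm (fun u => (hhpos u).le) hb hdec
  obtain ⟨κ, hκ, hκ'⟩ := exists_second_moment_eq hhm hhpos hrad hi
  have habs : 0 < |P.det| := abs_pos.mpr hP
  have hcov : ∀ {F : (ι → ℝ) → ℝ}, Measurable F → ∫ x, F x = |P.det| * ∫ u, F (m + P *ᵥ u) := by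
    intro F hF
    rw [integral_affine hF m hP, ← mul_assoc, mul_inv_cancel₀ habs.ne', one_mul]
  have hint1 : ∀ k, Integrable fun u : ι → ℝ => u k * h u := fun k =>
    integrable_mul_of_abs_le (by fun_prop) hhm (fun u => (hhpos u).le) hi fun u => by
      have := norm_le_pi_norm u k
      rw [Real.norm_eq_abs] at this
      nlinarith [norm_nonneg u]
  have hint2 : ∀ k l, Integrable fun u : ι → ℝ => u k * u l * h u := fun k l =>
    integrable_mul_of_abs_le (by fun_prop) hhm (fun u => (hhpos u).le) hi fun u => by
      have h1 := norm_le_pi_norm u k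
      have h2 := norm_le_pi_norm u l
      rw [Real.norm_eq_abs] at h1 h2
      rw [abs_mul]
      nlinarith [norm_nonneg u, abs_nonneg (u k), abs_nonneg (u l),
        mul_le_mul h1 h2 (abs_nonneg _) (norm_nonneg _)]
  have hzero : ∀ k, ∫ u, u k * h u = 0 := by
    intro k
    have := integral_orthogonal hhm hrad (Q := -1) (by simp) (g := fun u => u k) (by fun_prop)
    simp only [neg_mulVec, one_mulVec, Pi.neg_apply, neg_mul, integral_neg] at this
    linarith
  refine ⟨fun i => ?_, κ * |P.det|, by positivity, fun i j => ?_⟩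
  · have h0 : Integrable h := by
      refine (integrable_mul_of_abs_le (g := fun _ => 1) measurable_const hhm
        (fun u => (hhpos u).le) hi fun u => ?_).congr (by simp)
      rw [abs_one]
      nlinarith [norm_nonneg u]
    have h1 : |P.det| * ∫ u, h u = 1 := by rw [← hcov hm, hint]
    rw [hcov (by fun_prop : Measurable fun x => x i * ρ x)]
    have h2 : ∀ u, (m + P *ᵥ u) i * ρ (m + P *ᵥ u) = m i * h u + ∑ k, P i k * (u k * h u) := by
      intro u
      rw [Pi.add_apply, add_mul, mulVec, dotProduct, Finset.sum_mul]
      simp only [mul_assoc, hh]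
    simp_rw [h2]
    rw [integral_add (h0.const_mul _) (integrable_finsetSum _ fun k _ => (hint1 k).const_mul _),
      integral_finsetSum _ fun k _ => (hint1 k).const_mul _]
    simp_rw [integral_const_mul, hzero]
    rw [Finset.sum_eq_zero fun k _ => mul_zero _, add_zero, mul_left_comm, h1, mul_one]
  · rw [hcov (by fun_prop : Measurable fun x => (x i - m i) * (x j - m j) * ρ x)]
    have h2 : ∀ u, ((m + P *ᵥ u) i - m i) * ((m + P *ᵥ u) j - m j) * ρ (m + P *ᵥ u) =
        ∑ k, ∑ l, P i k * P j l * (u k * u l * h u) := by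
      intro u
      simp only [Pi.add_apply, add_sub_cancel_left, mulVec, dotProduct]
      rw [Finset.sum_mul_sum, Finset.sum_mul]
      refine Finset.sum_congr rfl fun k _ => ?_
      rw [Finset.sum_mul]
      refine Finset.sum_congr rfl fun l _ => ?_
      simp only [hh]
      ring
    simp_rw [h2]
    rw [integral_finsetSum _ fun k _ => integrable_finsetSum _ fun l _ =>
      (hint2 k l).const_mul _]
    simp_rw [integral_finsetSum _ fun l _ => (hint2 _ l).const_mul _, integral_const_mul, hκ']
    rw [← hPM, mul_apply]
    simp [one_apply, Finset.mul_sum]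
    refine Finset.sum_congr rfl fun k _ => ?_
    ring

end Moments

/-! ### Rotation invariance and product structure of the base Gaussian -/

section BaseGaussian

variable {s t : Type*} [Fintype s] [DecidableEq s] [Fintype t] [DecidableEq t]

theorem measurePreserving_shear_orthogonal (ν : t → ℝ) (D : Matrix t t ℝ) {Q : Matrix s s ℝ}
    (hQ : Q * Qᵀ = 1) :
    MeasurePreserving (shear (0 : s → ℝ) (0 : Matrix s t ℝ) Q) (baseGaussian s ν D)
      (baseGaussian s ν D) := by
  have hd : Q.det ≠ 0 := by
    intro h
    have := congrArg det hQ
    rw [det_mul, h] at this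
    simp at this
  refine ⟨(continuous_shear _ _ _).measurable, ?_⟩
  rw [map_shear_baseGaussian _ _ hd, baseGaussian, hQ]
  simp

theorem measurePreserving_sumElim_gaussian (ν : t → ℝ) {D : Matrix t t ℝ} (hD : D.PosDef) :
    MeasurePreserving (fun z : (t → ℝ) × (s → ℝ) => (Sum.elim z.2 z.1 : s ⊕ t → ℝ))
      ((densityMeasure (gaussianDensity ν D)).prod
        (densityMeasure (gaussianDensity (0 : s → ℝ) 1))) (baseGaussian s ν D) := by
  have hT := measurePreserving_sumElim (s := s) (t := t)
  refine ⟨hT.measurable, ?_⟩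
  have h1 : Measurable fun y => ENNReal.ofReal (gaussianDensity ν D y) :=
    (continuous_gaussianDensity _ _).measurable.ennreal_ofReal
  have h2 : Measurable fun x => ENNReal.ofReal (gaussianDensity (0 : s → ℝ) 1 x) :=
    (continuous_gaussianDensity _ _).measurable.ennreal_ofReal
  rw [densityMeasure, densityMeasure, prod_withDensity h1 h2]
  have key : ∀ z : (t → ℝ) × (s → ℝ), ENNReal.ofReal (gaussianDensity ν D z.1) *
      ENNReal.ofReal (gaussianDensity (0 : s → ℝ) 1 z.2) =
      ENNReal.ofReal (gaussianDensity (Sum.elim 0 ν) (fromBlocks 1 0 0 D) (Sum.elim z.2 z.1)) := by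
    intro z
    rw [(gaussianDensity_sumElim _ (posDef_fromBlocks_one hD) _ _).2,
      ← ENNReal.ofReal_mul (gaussianDensity_pos _ hD _).le, mul_comm]
    simp [condLoc, condScale]
  simp_rw [key]
  ext E hE
  rw [Measure.map_apply hT.measurable hE, withDensity_apply _ (hT.measurable hE), baseGaussian,
    densityMeasure, withDensity_apply _ hE]
  exact hT.setLIntegral_comp_preimage hE
    (continuous_gaussianDensity _ _).measurable.ennreal_ofReal

theorem measurePreserving_comp_inl (ν : t → ℝ) {D : Matrix t t ℝ} (hD : D.PosDef) :
    MeasurePreserving (fun z : s ⊕ t → ℝ => z ∘ Sum.inl) (baseGaussian s ν D)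
      (densityMeasure (gaussianDensity (0 : s → ℝ) 1)) := by
  have hT := measurePreserving_sumElim_gaussian (s := s) ν hD
  have hm : Measurable fun z : s ⊕ t → ℝ => z ∘ Sum.inl := by
    unfold Function.comp
    fun_prop
  have := isProbabilityMeasure_gaussian ν hD
  have := isProbabilityMeasure_gaussian (0 : s → ℝ) PosDef.one
  refine ⟨hm, ?_⟩
  rw [← hT.map_eq, Measure.map_map hm hT.measurable]
  exact (measurePreserving_snd (μ := densityMeasure (gaussianDensity ν D))
    (ν := densityMeasure (gaussianDensity (0 : s → ℝ) 1))).map_eq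

end BaseGaussian

/-- The inequality of arithmetic and geometric means for each pair `d k`, `d (σ k)`; the products of
the pairs multiply to `(∏ d)²` since `σ` permutes the factors. -/
theorem prod_lt_prod_average {ι : Type*} [Fintype ι] [DecidableEq ι] {d : ι → ℝ}
    (hd : ∀ i, 0 < d i) (σ : Equiv.Perm ι) {i : ι} (hi : d i ≠ d (σ i)) :
    ∏ k, d k < ∏ k, (d k + d (σ k)) / 2 := by
  have h1 : ∏ k, d k * d (σ k) < ∏ k, ((d k + d (σ k)) / 2) ^ 2 := by
    refine Finset.prod_lt_prod (fun k _ => mul_pos (hd _) (hd _)) (fun k _ => ?_)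
      ⟨i, Finset.mem_univ i, ?_⟩
    · nlinarith [sq_nonneg (d k - d (σ k))]
    · have : 0 < (d i - d (σ i)) ^ 2 := by
        have := sub_ne_zero.mpr hi
        positivity
      nlinarith
  rw [Finset.prod_mul_distrib, Equiv.prod_comp σ d, Finset.prod_pow, ← sq] at h1
  refine lt_of_pow_lt_pow_left₀ 2 (Finset.prod_nonneg fun k _ => ?_) h1
  have := hd k
  have := hd (σ k)
  positivity

/-- The standing assumptions: `p` is a probability density whose conditional densities are
positive, elliptically symmetric about `α + A y` with normalized covariance matrix `M`, and log
concave. -/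
structure EllipticalConditionals {s t : Type*} [Fintype s] [DecidableEq s] [Fintype t]
    (p : (s ⊕ t → ℝ) → ℝ) (M : Matrix s s ℝ) (α : s → ℝ) (A : Matrix s t ℝ) : Prop where
  measurable : Measurable p
  nonneg : ∀ z, 0 ≤ p z
  integral_eq : ∫ z, p z = 1
  elliptic : ∀ y, 0 < marginal p y → IsEllipticallySymmetric (condDensity p y) (α + A *ᵥ y) M
  pos : ∀ y, 0 < marginal p y → ∀ x, 0 < condDensity p y x
  logConcave : ∀ y, 0 < marginal p y → SomewhereStrictlyLogConcave (condDensity p y)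

/-! ### Symmetrization and concavity applied to minimizers -/

namespace EllipticalConditionals

variable {s t : Type*} [Fintype s] [DecidableEq s] [Fintype t] [DecidableEq t]
  {p : (s ⊕ t → ℝ) → ℝ} {M : Matrix s s ℝ} {α : s → ℝ} {A : Matrix s t ℝ}

theorem integrable (h : EllipticalConditionals p M α A) : Integrable p :=
  integrable_of_integral_eq_one h.integral_eq

theorem ae_good (h : EllipticalConditionals p M α A) (hpos : ∀ᵐ z, 0 < p z) :
    ∀ᵐ z : s ⊕ t → ℝ, 0 < marginal p (z ∘ Sum.inr) :=
  ae_comp_inr (ae_marginal_pos h.integrable hpos)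

theorem exists_good (h : EllipticalConditionals p M α A) (hpos : ∀ᵐ z, 0 < p z) :
    ∃ y, 0 < marginal p y :=
  (ae_marginal_pos h.integrable hpos).exists

theorem log_sumElim (h : EllipticalConditionals p M α A) {y : t → ℝ} (hy : 0 < marginal p y)
    (x : s → ℝ) : Real.log (p (Sum.elim x y)) =
      Real.log (condDensity p y x) + Real.log (marginal p y) := by
  have hc := h.pos y hy x
  rw [← Real.log_mul hc.ne' hy.ne', condDensity, div_mul_cancel₀ _ hy.ne']

theorem log_midpoint_le (h : EllipticalConditionals p M α A) {y : t → ℝ}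
    (hy : 0 < marginal p y) {x x' x'' : s → ℝ} (hx : x'' + x'' = x + x') :
    (Real.log (p (Sum.elim x y)) + Real.log (p (Sum.elim x' y))) / 2 ≤
      Real.log (p (Sum.elim x'' y)) := by
  rw [h.log_sumElim hy, h.log_sumElim hy, h.log_sumElim hy]
  linarith [(h.logConcave y hy).log_midpoint_le (h.pos y hy) hx]

/-- The base Gaussian is invariant under `w ↦ Q w`, so a change of parameters that a rotation of `w`
undoes leaves the expected log density unchanged. -/
theorem shear_orthogonal (h : EllipticalConditionals p M α A) (hpos : ∀ᵐ z, 0 < p z)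
    {ν : t → ℝ} {D : Matrix t t ℝ} (hD : D.PosDef) {b b' : s → ℝ} {B B' : Matrix s t ℝ}
    {C C' Q : Matrix s s ℝ} (hQ : Q * Qᵀ = 1)
    (heq : ∀ y, 0 < marginal p y → ∀ w : s → ℝ,
      p (Sum.elim (b + B *ᵥ y + C *ᵥ (Q *ᵥ w)) y) = p (Sum.elim (b' + B' *ᵥ y + C' *ᵥ w) y))
    (hi : Integrable (fun z => Real.log (p (shear b B C z))) (baseGaussian s ν D)) :
    Integrable (fun z => Real.log (p (shear b' B' C' z))) (baseGaussian s ν D) ∧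
      ∫ z, Real.log (p (shear b' B' C' z)) ∂baseGaussian s ν D =
        ∫ z, Real.log (p (shear b B C z)) ∂baseGaussian s ν D := by
  have hmp := measurePreserving_shear_orthogonal (s := s) ν D hQ
  have hae : (fun z => Real.log (p (shear b B C (shear (0 : s → ℝ) (0 : Matrix s t ℝ) Q z))))
      =ᵐ[baseGaussian s ν D] fun z => Real.log (p (shear b' B' C' z)) := by
    refine (ae_baseGaussian_iff ν hD).mpr ?_
    filter_upwards [h.ae_good hpos] with z hz
    simp only [shear, Sum.elim_comp_inr, Sum.elim_comp_inl, zero_mulVec, add_zero, zero_add]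
    rw [heq _ hz]
  have hlm : Measurable fun z => Real.log (p (shear b B C z)) :=
    (h.measurable.comp (continuous_shear b B C).measurable).log
  constructor
  · exact (hmp.integrable_comp_of_integrable hi).congr hae
  · rw [← integral_congr_ae hae]
    conv_rhs => rw [← hmp.map_eq]
    exact (integral_map hmp.measurable.aemeasurable hlm.aestronglyMeasurable).symm

/-- The sheared point is affine in `(b, B, C)`, so log concavity of each conditional applies
pointwise. The average of the two endpoints is an integrable lower bound, which is all that
integrability at the midpoint requires. -/
theorem shear_midpoint (h : EllipticalConditionals p M α A) (hpos : ∀ᵐ z, 0 < p z)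
    {ν : t → ℝ} {D : Matrix t t ℝ} (hD : D.PosDef) {b b' b'' : s → ℝ} {B B' B'' : Matrix s t ℝ}
    {C C' C'' : Matrix s s ℝ} (hC'' : C''.det ≠ 0) (hb : b'' + b'' = b + b')
    (hB : B'' + B'' = B + B') (hC : C'' + C'' = C + C')
    (hi : Integrable (fun z => Real.log (p (shear b B C z))) (baseGaussian s ν D))
    (hi' : Integrable (fun z => Real.log (p (shear b' B' C' z))) (baseGaussian s ν D)) :
    Integrable (fun z => Real.log (p (shear b'' B'' C'' z))) (baseGaussian s ν D) ∧
      (∀ᵐ z ∂baseGaussian s ν D,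
        (Real.log (p (shear b B C z)) + Real.log (p (shear b' B' C' z))) / 2 ≤
          Real.log (p (shear b'' B'' C'' z))) ∧
      (∫ z, Real.log (p (shear b B C z)) ∂baseGaussian s ν D +
        ∫ z, Real.log (p (shear b' B' C' z)) ∂baseGaussian s ν D) / 2 ≤
        ∫ z, Real.log (p (shear b'' B'' C'' z)) ∂baseGaussian s ν D := by
  have hle : ∀ᵐ z, (Real.log (p (shear b B C z)) + Real.log (p (shear b' B' C' z))) / 2 ≤
      Real.log (p (shear b'' B'' C'' z)) := by
    filter_upwards [h.ae_good hpos] with z hz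
    simp only [shear]
    refine h.log_midpoint_le hz ?_
    rw [add_add_add_comm, add_add_add_comm b'', hb, ← add_mulVec, ← add_mulVec, hB, hC, add_mulVec,
      add_mulVec]
    abel
  have hle' := (ae_baseGaussian_iff (s := s) ν hD).mpr hle
  have hi2 := (hi.add hi').div_const 2
  have hi'' := integrable_log_shear_of_le h.measurable h.integral_eq hpos hD hC'' hi2 hle
  refine ⟨hi'', hle', ?_⟩
  have := integral_mono_ae hi2 hi'' hle'
  simp only [Pi.add_apply] at this
  rwa [integral_div, integral_add hi hi'] at this

/-- A minimizer has the location of the conditional densities. -/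
theorem condLoc_eq (h : EllipticalConditionals p M α A) {ν : s ⊕ t → ℝ}
    {S : Matrix (s ⊕ t) (s ⊕ t) ℝ} (hmin : IsGaussianKLMinimizer p ν S)
    (htop : gaussianKL p ν S ≠ ⊤) (y : t → ℝ) : condLoc ν S y = α + A *ᵥ y := by
  have hm := h.measurable
  have hD : S.toBlocks₂₂.PosDef :=
    hmin.1.submatrix (e := (Sum.inr : t → s ⊕ t)) Sum.inr_injective
  have hpos := ((gaussianKL_ne_top_iff hm ν hmin.1).mp htop).1
  obtain ⟨C, hC0, hC⟩ := exists_mul_transpose_eq (gaussianDensity_sumElim ν hmin.1 0 0).1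
  obtain ⟨b, B, hb⟩ : ∃ (b : s → ℝ) (B : Matrix s t ℝ), ∀ y, b + B *ᵥ y = condLoc ν S y := by
    refine ⟨ν ∘ Sum.inl - (S.toBlocks₁₂ * S.toBlocks₂₂⁻¹) *ᵥ (ν ∘ Sum.inr),
      S.toBlocks₁₂ * S.toBlocks₂₂⁻¹, fun y => ?_⟩
    rw [condLoc, mulVec_sub]
    abel
  have hL := hmin.integrable_shear hm htop hC0 hb hC
  -- Reflecting `b + B y - C w` about `α + A y` gives `(2α - b) + (2A - B) y + C w`.
  have hrefl : ∀ y, 0 < marginal p y → ∀ w : s → ℝ,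
      p (Sum.elim (b + B *ᵥ y + C *ᵥ ((-1 : Matrix s s ℝ) *ᵥ w)) y) =
        p (Sum.elim ((α + α - b) + (A + A - B) *ᵥ y + C *ᵥ w) y) := by
    intro y hy w
    have h1 := (h.elliptic y hy).reflect (b + B *ᵥ y - C *ᵥ w - (α + A *ᵥ y))
    rw [add_sub_cancel, condDensity, condDensity, div_left_inj' hy.ne'] at h1
    rw [neg_mulVec, one_mulVec, mulVec_neg, ← sub_eq_add_neg, ← h1, sub_mulVec, add_mulVec]
    congr 2
    abel
  obtain ⟨hLneg, hInt⟩ := h.shear_orthogonal hpos hD (Q := -1) (by simp) hrefl hL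
  obtain ⟨hL2, hle, -⟩ := h.shear_midpoint hpos hD (b'' := α) (B'' := A) (C'' := C) hC0 (by abel)
    (by abel) rfl hL hLneg
  have hopt := hmin.shear_le hm h.nonneg h.integral_eq htop hC0 hb hC hC0 hL2
  have hI := (hL.add hLneg).div_const 2
  have hnn : 0 ≤ᵐ[baseGaussian s (ν ∘ Sum.inr) S.toBlocks₂₂] fun z =>
      Real.log (p (shear α A C z)) - (Real.log (p (shear b B C z)) +
        Real.log (p (shear (α + α - b) (A + A - B) C z))) / 2 := by
    filter_upwards [hle] with z hz using sub_nonneg.mpr hz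
  -- The midpoint has the same `C`, so the determinant terms cancel in `hopt`. The nonnegative
  -- concavity gap then has integral at most zero and vanishes almost everywhere.
  have hzero := (integral_eq_zero_iff_of_nonneg_ae hnn (hL2.sub hI)).mp (by
    refine le_antisymm ?_ (integral_nonneg_of_ae hnn)
    have e := integral_sub hL2 hI
    simp only [Pi.add_apply] at e
    rw [integral_div, integral_add hL hLneg, hInt] at e
    linarith)
  have hzero' := ae_ae_sumElim ((ae_baseGaussian_iff _ hD).mp hzero)
  have hae : (fun y => b + B *ᵥ y) =ᵐ[volume] fun y => α + A *ᵥ y := by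
    filter_upwards [hzero', ae_marginal_pos h.integrable hpos] with y hy hgood
    by_contra hne
    have hc : b + B *ᵥ y - (α + A *ᵥ y) ≠ 0 := sub_ne_zero.mpr hne
    obtain ⟨U, hU, ⟨x₀, hx₀⟩, hs⟩ := (h.logConcave y hgood).exists_open_log_lt (h.pos y hgood) hc
    -- The gap vanishes for almost every `w`, hence on a dense set, which meets the open set where
    -- strict concavity makes it positive.
    have hV : IsOpen ((fun w : s → ℝ => α + A *ᵥ y + C *ᵥ w) ⁻¹' U) := hU.preimage (by fun_prop)
    have hVne : ((fun w : s → ℝ => α + A *ᵥ y + C *ᵥ w) ⁻¹' U).Nonempty :=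
      ⟨C⁻¹ *ᵥ (x₀ - (α + A *ᵥ y)), by
        rw [Set.mem_preimage, mulVec_mulVec, mul_nonsing_inv _ hC0.isUnit, one_mulVec,
          add_sub_cancel]
        exact hx₀⟩
    obtain ⟨w, hwV, hw⟩ := (Measure.dense_of_ae hy).inter_open_nonempty _ hV hVne
    have h1 := hs _ hwV
    simp only [Set.mem_ofPred_eq, shear, Sum.elim_comp_inr, Sum.elim_comp_inl, Pi.zero_apply] at hw
    rw [h.log_sumElim hgood, h.log_sumElim hgood, h.log_sumElim hgood] at hw
    have e1 : α + A *ᵥ y + C *ᵥ w + (b + B *ᵥ y - (α + A *ᵥ y)) = b + B *ᵥ y + C *ᵥ w := by abel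
    have e2 : α + A *ᵥ y + C *ᵥ w - (b + B *ᵥ y - (α + A *ᵥ y)) =
        (α + α - b) + (A + A - B) *ᵥ y + C *ᵥ w := by
      rw [sub_mulVec, add_mulVec]
      abel
    rw [e1, e2] at h1
    linarith
  -- Affine functions that agree almost everywhere agree everywhere.
  have := (Continuous.ae_eq_iff_eq volume (by fun_prop) (by fun_prop)).mp hae
  rw [← hb]
  exact congrFun this y

/-- The scale of a minimizer is a multiple of the normalized covariance matrix. -/
theorem exists_condScale_eq [Nonempty s] (h : EllipticalConditionals p M α A) {ν : s ⊕ t → ℝ}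
    {S : Matrix (s ⊕ t) (s ⊕ t) ℝ} (hmin : IsGaussianKLMinimizer p ν S)
    (htop : gaussianKL p ν S ≠ ⊤) : ∃ γ : ℝ, 0 < γ ∧ condScale S = γ ^ 2 • M := by
  have hm := h.measurable
  have hD : S.toBlocks₂₂.PosDef :=
    hmin.1.submatrix (e := (Sum.inr : t → s ⊕ t)) Sum.inr_injective
  have hpos := ((gaussianKL_ne_top_iff hm ν hmin.1).mp htop).1
  have hMpos : M.PosDef := by
    obtain ⟨y, hy⟩ := h.exists_good hpos
    exact (h.elliptic y hy).posDef
  obtain ⟨P, d, hP, hd, hPM, hPS⟩ :=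
    exists_simultaneous_diagonalization hMpos (gaussianDensity_sumElim ν hmin.1 0 0).1
  have hb : ∀ y, α + A *ᵥ y = condLoc ν S y := fun y => (h.condLoc_eq hmin htop y).symm
  have hdet : ∀ e : s → ℝ, (P * diagonal e).det = P.det * ∏ k, e k := fun e => by
    rw [det_mul, det_diagonal]
  have hdet0 : ∀ e : s → ℝ, (∀ k, 0 < e k) → (P * diagonal e).det ≠ 0 := fun e he => by
    rw [hdet]
    exact mul_ne_zero hP (Finset.prod_pos fun k _ => he k).ne'
  have heq : ∀ i j, d i = d j := by
    intro i j
    by_contra hij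
    set σ := Equiv.swap i j with hσ
    have hσσ : ∀ k, σ (σ k) = k := fun k => Equiv.swap_apply_self i j k
    have hQ : σ.permMatrix ℝ * (σ.permMatrix ℝ)ᵀ = 1 := by
      rw [transpose_permMatrix, ← permMatrix_mul]
      simp
    have hL := hmin.integrable_shear hm htop (hdet0 d hd) hb hPS
    -- Both points have the same Euclidean norm in the coordinates given by `P`, as their entries
    -- differ by the permutation `σ`.
    have hswap : ∀ y, 0 < marginal p y → ∀ w : s → ℝ,
        p (Sum.elim (α + A *ᵥ y + (P * diagonal d) *ᵥ (σ.permMatrix ℝ *ᵥ w)) y) =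
          p (Sum.elim (α + A *ᵥ y + (P * diagonal fun k => d (σ k)) *ᵥ w) y) := by
      intro y hy w
      have h1 := (h.elliptic y hy).eq_of_dotProduct_eq hP hPM (u := diagonal d *ᵥ (w ∘ σ))
        (v := (diagonal fun k => d (σ k)) *ᵥ w) (by
          simp only [dotProduct, mulVec_diagonal, Function.comp]
          rw [← Equiv.sum_comp σ]
          simp [hσσ])
      rwa [condDensity, condDensity, div_left_inj' hy.ne', mulVec_mulVec, mulVec_mulVec,
        ← permMatrix_mulVec] at h1
    obtain ⟨hL1, hInt⟩ := h.shear_orthogonal hpos hD hQ hswap hL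
    set e : s → ℝ := fun k => (d k + d (σ k)) / 2 with he
    have hepos : ∀ k, 0 < e k := fun k => by
      have := hd k
      have := hd (σ k)
      simp only [he]
      positivity
    have hsum : P * diagonal e + P * diagonal e =
        P * diagonal d + P * diagonal fun k => d (σ k) := by
      rw [← Matrix.mul_add, ← Matrix.mul_add, diagonal_add, diagonal_add]
      congr 2
      ext k
      simp only [he]
      ring
    obtain ⟨hL2, -, hmono⟩ := h.shear_midpoint hpos hD (hdet0 e hepos) rfl rfl hsum hL hL1
    have hopt := hmin.shear_le hm h.nonneg h.integral_eq htop (hdet0 d hd) hb hPS (hdet0 e hepos)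
      hL2
    rw [hInt] at hmono
    -- The averaged diagonal does no worse in expected log density and has a strictly larger
    -- determinant, contradicting optimality.
    have hlt : ∏ k, d k < ∏ k, e k :=
      prod_lt_prod_average hd σ (i := i) (by rwa [hσ, Equiv.swap_apply_left])
    have hdp : 0 < ∏ k, d k := Finset.prod_pos fun k _ => hd k
    have hlog : Real.log |(P * diagonal d).det| < Real.log |(P * diagonal e).det| := by
      refine Real.log_lt_log (abs_pos.mpr (hdet0 d hd)) ?_
      rw [hdet, hdet, abs_mul, abs_mul, abs_of_pos hdp, abs_of_pos (hdp.trans hlt)]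
      exact mul_lt_mul_of_pos_left hlt (abs_pos.mpr hP)
    linarith
  refine ⟨d (Classical.arbitrary s), hd _, ?_⟩
  have hdc : diagonal d = d (Classical.arbitrary s) • (1 : Matrix s s ℝ) := by
    rw [smul_one_eq_diagonal]
    congr 1
    ext k
    exact heq _ _
  rw [← hPS, hdc, mul_smul_comm, Matrix.mul_one, transpose_smul, smul_mul_smul_comm, hPM, sq]

/-- Strict concavity in the scale: any other scale with finite expected log density does strictly
worse than that of a minimizer. -/
theorem shear_lt_of_ne [Nonempty s] (h : EllipticalConditionals p M α A) {ν : s ⊕ t → ℝ}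
    {S : Matrix (s ⊕ t) (s ⊕ t) ℝ} (hmin : IsGaussianKLMinimizer p ν S)
    (htop : gaussianKL p ν S ≠ ⊤) {P : Matrix s s ℝ} (hP : P.det ≠ 0) (hPM : P * Pᵀ = M)
    {γ γ' : ℝ} (hγ : 0 < γ) (hγ' : 0 < γ') (hS : condScale S = γ ^ 2 • M) (hne : γ ≠ γ')
    (hi' : Integrable (fun z => Real.log (p (shear α A (γ' • P) z)))
      (baseGaussian s (ν ∘ Sum.inr) S.toBlocks₂₂)) :
    Fintype.card s * Real.log γ' + ∫ z, Real.log (p (shear α A (γ' • P) z))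
        ∂baseGaussian s (ν ∘ Sum.inr) S.toBlocks₂₂ <
      Fintype.card s * Real.log γ + ∫ z, Real.log (p (shear α A (γ • P) z))
        ∂baseGaussian s (ν ∘ Sum.inr) S.toBlocks₂₂ := by
  have hm := h.measurable
  have hD : S.toBlocks₂₂.PosDef :=
    hmin.1.submatrix (e := (Sum.inr : t → s ⊕ t)) Sum.inr_injective
  have hpos := ((gaussianKL_ne_top_iff hm ν hmin.1).mp htop).1
  have hb : ∀ y, α + A *ᵥ y = condLoc ν S y := fun y => (h.condLoc_eq hmin htop y).symm
  have hdet0 : ∀ {c : ℝ}, 0 < c → (c • P).det ≠ 0 := fun {c} hc => by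
    rw [det_smul]
    exact mul_ne_zero (by positivity) hP
  have hlogdet : ∀ {c : ℝ}, 0 < c →
      Real.log |(c • P).det| = Fintype.card s * Real.log c + Real.log |P.det| := fun {c} hc => by
    rw [det_smul, abs_mul, Real.log_mul (by positivity) (abs_pos.mpr hP).ne', abs_of_pos
      (by positivity), Real.log_pow]
  have hPS : (γ • P) * (γ • P)ᵀ = condScale S := by
    rw [transpose_smul, smul_mul_smul_comm, hPM, hS, sq]
  have hL := hmin.integrable_shear hm htop (hdet0 hγ) hb hPS
  -- Minimality is used only against the mean scale `δ`: its objective is at most that at `γ`, yet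
  -- strictly exceeds the average of those at `γ` and `γ'`.
  set δ := (γ + γ') / 2 with hδ
  have hδ0 : 0 < δ := by positivity
  obtain ⟨hL2, -, hmono⟩ := h.shear_midpoint hpos hD (hdet0 hδ0) rfl rfl
    (show δ • P + δ • P = γ • P + γ' • P by rw [← add_smul, ← add_smul, hδ, add_halves]) hL hi'
  have hopt := hmin.shear_le hm h.nonneg h.integral_eq htop (hdet0 hγ) hb hPS (hdet0 hδ0) hL2
  rw [hlogdet hδ0, hlogdet hγ] at hopt
  have hlog : (Real.log γ + Real.log γ') / 2 < Real.log δ := by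
    have h1 : γ * γ' < δ ^ 2 := by
      have := sub_ne_zero.mpr hne
      have : 0 < (γ - γ') ^ 2 := by positivity
      rw [hδ]
      nlinarith
    have h2 := Real.log_lt_log (by positivity) h1
    rw [Real.log_mul hγ.ne' hγ'.ne', Real.log_pow] at h2
    push_cast at h2
    linarith
  have hcard : (0 : ℝ) < Fintype.card s := by exact_mod_cast Fintype.card_pos
  have := mul_lt_mul_of_pos_left hlog hcard
  linarith

theorem integrable_shear_scale (h : EllipticalConditionals p M α A) {ν : s ⊕ t → ℝ}
    {S : Matrix (s ⊕ t) (s ⊕ t) ℝ} (hmin : IsGaussianKLMinimizer p ν S)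
    (htop : gaussianKL p ν S ≠ ⊤) {P : Matrix s s ℝ} (hP : P.det ≠ 0) (hPM : P * Pᵀ = M)
    {γ : ℝ} (hγ : 0 < γ) (hS : condScale S = γ ^ 2 • M) :
    Integrable (fun z => Real.log (p (shear α A (γ • P) z)))
      (baseGaussian s (ν ∘ Sum.inr) S.toBlocks₂₂) := by
  refine hmin.integrable_shear h.measurable htop ?_ (fun y => (h.condLoc_eq hmin htop y).symm) ?_
  · rw [det_smul]
    exact mul_ne_zero (by positivity) hP
  · rw [transpose_smul, smul_mul_smul_comm, hPM, hS, sq]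

/-- If the conditional densities are translates of each other, then the expected log density
splits into a part that depends on the scale only and one that depends on the marginal only. -/
theorem log_shear_ae_eq (h : EllipticalConditionals p M α A) (hpos : ∀ᵐ z, 0 < p z)
    {y₀ : t → ℝ} (hconst : ∀ y, 0 < marginal p y → ∀ v,
      condDensity p y (α + A *ᵥ y + v) = condDensity p y₀ (α + A *ᵥ y₀ + v))
    (C : Matrix s s ℝ) :
    ∀ᵐ z : s ⊕ t → ℝ, Real.log (p (shear α A C z)) =
      Real.log (condDensity p y₀ (α + A *ᵥ y₀ + C *ᵥ (z ∘ Sum.inl))) +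
        Real.log (marginal p (z ∘ Sum.inr)) := by
  filter_upwards [h.ae_good hpos] with z hz
  rw [shear, h.log_sumElim hz, hconst _ hz]

/-- By Fubini almost every section in `y` is integrable, and on a section the log marginal is a
constant. -/
theorem integrable_log_condDensity (h : EllipticalConditionals p M α A) (hpos : ∀ᵐ z, 0 < p z)
    {y₀ : t → ℝ} (hconst : ∀ y, 0 < marginal p y → ∀ v,
      condDensity p y (α + A *ᵥ y + v) = condDensity p y₀ (α + A *ᵥ y₀ + v))
    {C : Matrix s s ℝ} {ν : t → ℝ} {D : Matrix t t ℝ} (hD : D.PosDef)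
    (hi : Integrable (fun z => Real.log (p (shear α A C z))) (baseGaussian s ν D)) :
    Integrable (fun w => Real.log (condDensity p y₀ (α + A *ᵥ y₀ + C *ᵥ w)))
      (densityMeasure (gaussianDensity (0 : s → ℝ) 1)) := by
  have := isProbabilityMeasure_gaussian ν hD
  have := isProbabilityMeasure_gaussian (0 : s → ℝ) PosDef.one
  have h1 := hi.congr ((ae_baseGaussian_iff ν hD).mpr (h.log_shear_ae_eq hpos hconst C))
  have h2 := (measurePreserving_sumElim_gaussian (s := s) ν hD).integrable_comp_of_integrable h1
  obtain ⟨y, hy⟩ := h2.prod_right_ae.exists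
  simp only [Function.comp_def] at hy
  refine (hy.sub (integrable_const (Real.log (marginal p y)))).congr
    (Filter.Eventually.of_forall fun w => ?_)
  simp

theorem condMean_condCov [Nonempty s] (h : EllipticalConditionals p M α A) {y : t → ℝ}
    (hy : 0 < marginal p y) :
    condMean p y = α + A *ᵥ y ∧ ∃ κ : ℝ, 0 < κ ∧ condCov p y = κ • M := by
  have hm : Measurable (condDensity p y) := by
    have h1 : Measurable fun x : s → ℝ => (Sum.elim x y : s ⊕ t → ℝ) :=
      (measurePreserving_sumElim (s := s) (t := t)).measurable.comp measurable_prodMk_left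
    exact (h.measurable.comp h1).div_const _
  have hint : ∫ x, condDensity p y x = 1 := by
    simp only [condDensity]
    rw [integral_div]
    exact div_self hy.ne'
  obtain ⟨hmean, κ, hκ, hcov⟩ :=
    (h.logConcave y hy).moments hm (h.pos y hy) (h.elliptic y hy) hint
  have hmean' : condMean p y = α + A *ᵥ y := funext hmean
  refine ⟨hmean', κ, hκ, ?_⟩
  ext i j
  rw [condCov, of_apply, hmean', hcov, Matrix.smul_apply, smul_eq_mul]

/-- A change of scale alters the expected log density by an amount that does not depend on the
marginal. -/
theorem integral_log_shear_sub (h : EllipticalConditionals p M α A) (hpos : ∀ᵐ z, 0 < p z)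
    {y₀ : t → ℝ} (hconst : ∀ y, 0 < marginal p y → ∀ v,
      condDensity p y (α + A *ᵥ y + v) = condDensity p y₀ (α + A *ᵥ y₀ + v))
    {C C' : Matrix s s ℝ} {ν : t → ℝ} {D : Matrix t t ℝ} (hD : D.PosDef)
    (hi : Integrable (fun z => Real.log (p (shear α A C z))) (baseGaussian s ν D))
    (hF : Integrable (fun w => Real.log (condDensity p y₀ (α + A *ᵥ y₀ + C *ᵥ w)))
      (densityMeasure (gaussianDensity (0 : s → ℝ) 1)))
    (hF' : Integrable (fun w => Real.log (condDensity p y₀ (α + A *ᵥ y₀ + C' *ᵥ w)))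
      (densityMeasure (gaussianDensity (0 : s → ℝ) 1))) :
    Integrable (fun z => Real.log (p (shear α A C' z))) (baseGaussian s ν D) ∧
      ∫ z, Real.log (p (shear α A C' z)) ∂baseGaussian s ν D -
        ∫ z, Real.log (p (shear α A C z)) ∂baseGaussian s ν D =
      ∫ w, Real.log (condDensity p y₀ (α + A *ᵥ y₀ + C' *ᵥ w))
          ∂densityMeasure (gaussianDensity (0 : s → ℝ) 1) -
        ∫ w, Real.log (condDensity p y₀ (α + A *ᵥ y₀ + C *ᵥ w))
          ∂densityMeasure (gaussianDensity (0 : s → ℝ) 1) := by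
  have hmp := measurePreserving_comp_inl (s := s) ν hD
  -- In the difference of the two scales the log marginal cancels, so its own integrability is not
  -- needed.
  have hG : Integrable (fun z : s ⊕ t → ℝ =>
      Real.log (condDensity p y₀ (α + A *ᵥ y₀ + C' *ᵥ (z ∘ Sum.inl))) -
        Real.log (condDensity p y₀ (α + A *ᵥ y₀ + C *ᵥ (z ∘ Sum.inl)))) (baseGaussian s ν D) := by
    have h1 := hmp.integrable_comp_of_integrable hF
    have h2 := hmp.integrable_comp_of_integrable hF'
    simp only [Function.comp_def] at h1 h2
    exact h2.sub h1
  have hint : ∫ z : s ⊕ t → ℝ, (Real.log (condDensity p y₀ (α + A *ᵥ y₀ + C' *ᵥ (z ∘ Sum.inl))) -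
      Real.log (condDensity p y₀ (α + A *ᵥ y₀ + C *ᵥ (z ∘ Sum.inl)))) ∂baseGaussian s ν D =
      ∫ w, (Real.log (condDensity p y₀ (α + A *ᵥ y₀ + C' *ᵥ w)) -
        Real.log (condDensity p y₀ (α + A *ᵥ y₀ + C *ᵥ w)))
        ∂densityMeasure (gaussianDensity (0 : s → ℝ) 1) := by
    rw [← hmp.map_eq] at hF hF'
    conv_rhs => rw [← hmp.map_eq]
    exact (integral_map hmp.measurable.aemeasurable
      (hF'.sub hF).aestronglyMeasurable).symm
  have hae : (fun z => Real.log (p (shear α A C z)) +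
      (Real.log (condDensity p y₀ (α + A *ᵥ y₀ + C' *ᵥ (z ∘ Sum.inl))) -
        Real.log (condDensity p y₀ (α + A *ᵥ y₀ + C *ᵥ (z ∘ Sum.inl)))))
      =ᵐ[baseGaussian s ν D] fun z => Real.log (p (shear α A C' z)) := by
    refine (ae_baseGaussian_iff ν hD).mpr ?_
    filter_upwards [h.log_shear_ae_eq hpos hconst C, h.log_shear_ae_eq hpos hconst C'] with z h1 h2
    rw [h1, h2]
    ring
  refine ⟨(hi.add hG).congr hae, ?_⟩
  rw [← integral_sub hF' hF, ← hint, ← integral_congr_ae hae, integral_add hi hG]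
  exact add_sub_cancel_left _ _

end EllipticalConditionals

theorem eq_of_sq_smul_eq {ι : Type*} {M : Matrix ι ι ℝ} (hM : M ≠ 0) {γ γ' : ℝ}
    (hγ : 0 < γ) (hγ' : 0 < γ') (h : γ ^ 2 • M = γ' ^ 2 • M) : γ = γ' :=
  (sq_eq_sq₀ hγ.le hγ'.le).mp (smul_left_injective ℝ hM h)

end EllipticalVI

/-! ### The main theorem -/

open EllipticalVI
theorem theorem5 {s t : Type*} [Fintype s] [DecidableEq s] [Nonempty s]
    [Fintype t] [DecidableEq t]
    (p : (s ⊕ t → ℝ) → ℝ) (hp_meas : Measurable p) (hp_nonneg : ∀ z, 0 ≤ p z)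
    (hp_int : ∫ z, p z = 1)
    (M : Matrix s s ℝ) (α : s → ℝ) (A : Matrix s t ℝ)
    (hp_ell : ∀ y, 0 < marginal p y →
      IsEllipticallySymmetric (condDensity p y) (α + A *ᵥ y) M)
    (f : (t → ℝ) → ℝ → ℝ)
    (hf : ∀ y, 0 < marginal p y → ∀ x,
      condDensity p y x =
        Real.exp (f y (mahalanobis M (α + A *ᵥ y) x)) / √M.det)
    (hf_smooth : ∀ y, 0 < marginal p y → ContDiffOn ℝ 1 (f y) (Set.Ici 0))
    (hp_conc : ∀ y, 0 < marginal p y →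
      SomewhereStrictlyLogConcave (condDensity p y))
    (hfin : ∃ (ν : s ⊕ t → ℝ) (S : Matrix (s ⊕ t) (s ⊕ t) ℝ),
      S.PosDef ∧ gaussianKL p ν S ≠ ⊤) :
    -- every minimizer recovers the conditional mean, and the conditional covariance up to scale
    (∀ (ν : s ⊕ t → ℝ) (S : Matrix (s ⊕ t) (s ⊕ t) ℝ),
      IsGaussianKLMinimizer p ν S →
        (∀ y, 0 < marginal p y →
          condLoc ν S y = condMean p y) ∧
        (∀ y, 0 < marginal p y →
          ∃! γ : ℝ, 0 < γ ∧ condScale S = γ ^ 2 • condCov p y) ∧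
        (∃! γ : ℝ, 0 < γ ∧ condScale S = γ ^ 2 • M)) ∧
    -- the factor is the same for all minimizers with the same marginal in the last block, and
    -- for all minimizers whatsoever if the radial profile of the conditional density is constant
    (∀ (ν ν' : s ⊕ t → ℝ) (S S' : Matrix (s ⊕ t) (s ⊕ t) ℝ),
      IsGaussianKLMinimizer p ν S → IsGaussianKLMinimizer p ν' S' →
        ((ν ∘ Sum.inr = ν' ∘ Sum.inr ∧ S.toBlocks₂₂ = S'.toBlocks₂₂) ∨
          (∀ y y', 0 < marginal p y → 0 < marginal p y' →
            ∀ r, 0 ≤ r → f y r = f y' r)) →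
        condScale S = condScale S') := by
  have hM0 : ∀ {y}, 0 < marginal p y → M.PosDef := fun hy => (hp_ell _ hy).posDef
  have h : EllipticalConditionals p M α A :=
    ⟨hp_meas, hp_nonneg, hp_int, hp_ell, fun y hy x => by
      have := (hM0 hy).det_pos
      rw [hf y hy]
      positivity, hp_conc⟩
  have hpos : ∀ᵐ z, 0 < p z := by
    obtain ⟨ν, S, hS, hfin'⟩ := hfin
    exact ((gaussianKL_ne_top_iff hp_meas ν hS).mp hfin').1
  obtain ⟨y₀, hy₀⟩ := h.exists_good hpos
  have hM := hM0 hy₀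
  have hMne : M ≠ 0 := by
    rintro rfl
    have := hM.det_pos
    simp at this
  constructor
  · intro ν S hmin
    have htop := hmin.gaussianKL_ne_top hfin
    obtain ⟨γ₀, hγ₀, hγ₀'⟩ := h.exists_condScale_eq hmin htop
    refine ⟨fun y hy => ?_, fun y hy => ?_, γ₀, ⟨hγ₀, hγ₀'⟩, ?_⟩
    · rw [h.condLoc_eq hmin htop, (h.condMean_condCov hy).1]
    · obtain ⟨κ, hκ, hcov⟩ := (h.condMean_condCov hy).2
      have hsq : √κ ^ 2 = κ := Real.sq_sqrt hκ.le
      -- Since `condCov p y = κ • M`, the factor relative to the covariance is that relative to `M`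
      -- divided by `√κ`.
      refine ⟨γ₀ / √κ, ⟨by positivity, ?_⟩, ?_⟩
      · rw [hcov, smul_smul, div_pow, hsq, div_mul_cancel₀ _ hκ.ne', hγ₀']
      · rintro γ ⟨hγ, hγ'⟩
        refine (eq_div_iff (Real.sqrt_pos.mpr hκ).ne').mpr ?_
        refine eq_of_sq_smul_eq hMne (by positivity) hγ₀ ?_
        rw [mul_pow, hsq, ← smul_smul, ← hcov, ← hγ', hγ₀']
    · rintro γ ⟨hγ, hγ'⟩
      exact eq_of_sq_smul_eq hMne hγ hγ₀ (hγ'.symm.trans hγ₀')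
  · intro ν ν' S S' hmin hmin' hor
    have htop := hmin.gaussianKL_ne_top hfin
    have htop' := hmin'.gaussianKL_ne_top hfin
    obtain ⟨γ, hγ, hS⟩ := h.exists_condScale_eq hmin htop
    obtain ⟨γ', hγ', hS'⟩ := h.exists_condScale_eq hmin' htop'
    obtain ⟨P, hP, hPM⟩ := exists_mul_transpose_eq hM
    by_contra hne
    have hne' : γ ≠ γ' := by
      rintro rfl
      exact hne (hS.trans hS'.symm)
    have hL := h.integrable_shear_scale hmin htop hP hPM hγ hS
    have hL' := h.integrable_shear_scale hmin' htop' hP hPM hγ' hS'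
    rcases hor with ⟨e1, e2⟩ | hprofile
    -- With a common marginal each of the two scales would be strictly better than the other.
    · rw [e1, e2] at hL
      have h2 := h.shear_lt_of_ne hmin' htop' hP hPM hγ' hγ hS' hne'.symm hL
      rw [← e1, ← e2] at hL'
      have h1 := h.shear_lt_of_ne hmin htop hP hPM hγ hγ' hS hne' hL'
      rw [e1, e2] at h1
      exact lt_asymm h1 h2
    · have hconst : ∀ y, 0 < marginal p y → ∀ v,
          condDensity p y (α + A *ᵥ y + v) = condDensity p y₀ (α + A *ᵥ y₀ + v) := by
        intro y hy v
        rw [hf y hy, hf y₀ hy₀]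
        simp only [mahalanobis, add_sub_cancel_left]
        rw [hprofile y y₀ hy hy₀ _ (Real.sqrt_nonneg _)]
      have hD : S.toBlocks₂₂.PosDef :=
        hmin.1.submatrix (e := (Sum.inr : t → s ⊕ t)) Sum.inr_injective
      have hD' : S'.toBlocks₂₂.PosDef :=
        hmin'.1.submatrix (e := (Sum.inr : t → s ⊕ t)) Sum.inr_injective
      have hF := h.integrable_log_condDensity hpos hconst hD hL
      have hF' := h.integrable_log_condDensity hpos hconst hD' hL'
      -- Passing from `γ` to `γ'` under the first marginal and back under the second changes the
      -- expected log density by opposite amounts. The two strict inequalities below therefore add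
      -- up to a contradiction.
      obtain ⟨hi', d⟩ := h.integral_log_shear_sub hpos hconst hD hL hF hF'
      obtain ⟨hi, d'⟩ := h.integral_log_shear_sub hpos hconst hD' hL' hF' hF
      have h1 := h.shear_lt_of_ne hmin htop hP hPM hγ hγ' hS hne' hi'
      have h2 := h.shear_lt_of_ne hmin' htop' hP hPM hγ' hγ hS' hne'.symm hi
      linarith
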